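/- Let $\mathbb{T}=\mathbb{R}/\mathbb{Z}$ and let $C^1(\mathbb{T})$ carry its usual norm. Fix $x_0\in\mathbb{T}$ and, for $f\in C^0(\mathbb{T})$ with mean-zero part $f_0:=f-\int_{\mathbb{T}}f\,dz$, put $$\partial_x^{-1}f(x):=\int_{x_0}^x f_0(y)\,dy-\int_{\mathbb{T}}\int_{x_0}^{x}f_0(y)\,dy\,dx ,$$ so that $\partial_x^{-1}f\in C^1(\mathbb{T})$ is the mean-zero function with $\partial_x\partial_x^{-1}f=f-\int_{\mathbb{T}} f\,dz$. Let $p\ge 1$ be an integer. For $u_0\in C^1(\mathbb{T})$ and $T>0$, a solution on $[0,T)$ with data $u_0$ is a function $$u\in C^0([0,T),C^1(\mathbb{T}))\cap C^1([0,T),L^\infty(\mathbb{T}))$$ with $u(0)=u_0$ and, for every $t\in[0,T)$, as an identity in $L^\infty(\mathbb{T})$, $$\partial_t u+u^p\,\partial_x u=\tfrac12\,\partial_x^{-1}\bigl(\partial_x(u^p)\,\partial_x u\bigr). \tag{mHS}$$ Theorem (local well-posedness in $C^1$). (i) For every $T>0$ and every $u_0\in C^1(\mathbb{T})$, any two solutions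 on $[0,T)$ with data $u_0$ coincide. (ii) For every $u_0\in C^1(\mathbb{T})$ there are $T>0$ and $r>0$ such that for every $v_0\in C^1(\mathbb{T})$ with $\|v_0-u_0\|_{C^1}<r$ there is a solution $S(v_0)$ on $[0,T)$ with data $v_0$ (unique by (i)), and it depends continuously on the data: whenever $\|v_0-u_0\|_{C^1}<r$ and $w_0\to v_0$ in $C^1(\mathbb{T})$, then $S(w_0)\to S(v_0)$ in $C^1(\mathbb{T})$ and $\partial_tS(w_0)\to\partial_tS(v_0)$ in $L^\infty(\mathbb{T})$, both uniformly on $[0,T)$. -/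

import Mathlib

open Set Filter Topology MeasureTheory
open scoped ENNReal

noncomputable section

/-- The Banach space `C¹(𝕋)`, `𝕋 = ℝ / ℤ`. An element is a continuous function `f` on the circle
together with its derivative `g = ∂ₓ f`, which is required to exist everywhere and to be
continuous; `g` is determined by `f`. The norm is the `C¹` norm `max ‖f‖_∞ ‖∂ₓ f‖_∞`. -/
def C1Circle : Submodule ℝ (C(UnitAddCircle, ℝ) × C(UnitAddCircle, ℝ)) where
  carrier := {fg | ∀ x : ℝ, HasDerivAt (fun y : ℝ => fg.1 (y : UnitAddCircle))
    (fg.2 (x : UnitAddCircle)) x}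
  add_mem' := fun ha hb x => (ha x).add (hb x)
  zero_mem' := fun x => hasDerivAt_const x (0 : ℝ)
  smul_mem' := fun c _ ha x => (ha x).const_mul c

namespace C1Circle

/-- The underlying continuous function. -/
def fn (u : C1Circle) : C(UnitAddCircle, ℝ) := u.1.1

/-- The space derivative `∂ₓ u`. -/
def dx (u : C1Circle) : C(UnitAddCircle, ℝ) := u.1.2

/-- The power `u ^ p` as a `C¹` function. -/
def pow (u : C1Circle) (p : ℕ) : C1Circle :=
  ⟨(fn u ^ p, (p : ℝ) • (fn u ^ (p - 1) * dx u)), fun x => by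
    have h := (u.2 x).fun_pow p
    simpa [fn, dx, mul_assoc] using h⟩

end C1Circle

/-- `x ↦ ∫_{x₀}^x (f - ∫_𝕋 f) dy` on the real line. -/
def primitiveFrom (x₀ : ℝ) (f : C(UnitAddCircle, ℝ)) (x : ℝ) : ℝ :=
  ∫ y in x₀..x, (f (y : UnitAddCircle) - ∫ z : UnitAddCircle, f z)

theorem continuous_sub_mean (f : C(UnitAddCircle, ℝ)) :
    Continuous (fun y : ℝ => f (y : UnitAddCircle) - ∫ z : UnitAddCircle, f z) :=
  (f.continuous.comp (AddCircle.continuous_mk' 1)).sub continuous_const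

theorem primitiveFrom_periodic (x₀ : ℝ) (f : C(UnitAddCircle, ℝ)) :
    Function.Periodic (primitiveFrom x₀ f) 1 := by
  intro x
  have hi : ∀ a b : ℝ, IntervalIntegrable
      (fun y : ℝ => f (y : UnitAddCircle) - ∫ z : UnitAddCircle, f z) volume a b :=
    fun a b => (continuous_sub_mean f).intervalIntegrable a b
  have hf : IntervalIntegrable (fun y : ℝ => f (y : UnitAddCircle)) volume x (x + 1) :=
    (f.continuous.comp (AddCircle.continuous_mk' 1)).intervalIntegrable _ _
  have h0 : ∫ y in x..(x + 1), (f (y : UnitAddCircle) - ∫ z : UnitAddCircle, f z) = 0 := by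
    rw [intervalIntegral.integral_sub hf intervalIntegrable_const,
      UnitAddCircle.intervalIntegral_preimage x (fun z => f z)]
    simp
  unfold primitiveFrom
  rw [← intervalIntegral.integral_add_adjacent_intervals (hi x₀ x) (hi x (x + 1)), h0, add_zero]

/-- The function `x ↦ ∫_{x₀}^x (f - ∫_𝕋 f) dy` on the circle. -/
def circlePrimitive (x₀ : ℝ) (f : C(UnitAddCircle, ℝ)) : C(UnitAddCircle, ℝ) where
  toFun := (primitiveFrom_periodic x₀ f).lift
  continuous_toFun := by
    refine continuous_coinduced_dom.mpr ?_
    exact intervalIntegral.continuous_primitive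
      (fun a b => (continuous_sub_mean f).intervalIntegrable a b) x₀

/-- The operator `∂ₓ⁻¹ : C⁰(𝕋) → C¹(𝕋) ⊆ C⁰(𝕋)`, which sends `f` to the mean zero primitive of
the mean zero part `f₀ = f - ∫_𝕋 f` of `f`:
`∂ₓ⁻¹ f (x) = ∫_{x₀}^x f₀(y) dy - ∫_𝕋 ∫_{x₀}^x f₀(y) dy dx`. -/
def dxInv (x₀ : ℝ) (f : C(UnitAddCircle, ℝ)) : C(UnitAddCircle, ℝ) :=
  circlePrimitive x₀ f -
    ContinuousMap.const UnitAddCircle (∫ x : UnitAddCircle, circlePrimitive x₀ f x)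

/-- The class in `L^∞(𝕋)` of a continuous function. -/
def toLinf (f : C(UnitAddCircle, ℝ)) : Lp ℝ ∞ (volume : Measure UnitAddCircle) :=
  ContinuousMap.toLp ∞ (volume : Measure UnitAddCircle) ℝ f

/-- The time derivative `∂ₜ u (t) ∈ L^∞(𝕋)` of a curve `u` on `[0, T)`
(one-sided at `t = 0`). -/
def timeDeriv (T : ℝ) (u : ℝ → C1Circle) (t : ℝ) : Lp ℝ ∞ (volume : Measure UnitAddCircle) :=
  derivWithin (fun s => toLinf (C1Circle.fn (u s))) (Ico 0 T) t

/-- `u` is a solution on `[0, T)`, in the class `C⁰([0,T), C¹(𝕋)) ∩ C¹([0,T), L^∞(𝕋))`, of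
`∂ₜ u + u ^ p ∂ₓ u = (1/2) ∂ₓ⁻¹ (∂ₓ (u ^ p) ∂ₓ u)`, `u(0) = u₀`. Only the values of `u` on
`[0, T)` matter. -/
structure IsMHSSolution (p : ℕ) (x₀ T : ℝ) (u₀ : C1Circle) (u : ℝ → C1Circle) : Prop where
  initial : u 0 = u₀
  continuousOn : ContinuousOn u (Ico 0 T)
  contDiffOn : ContDiffOn ℝ 1 (fun t => toLinf (C1Circle.fn (u t))) (Ico 0 T)
  equation : ∀ t ∈ Ico 0 T,
    timeDeriv T u t + toLinf (C1Circle.fn (u t) ^ p * C1Circle.dx (u t)) =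
      toLinf ((1 / 2 : ℝ) • dxInv x₀ (C1Circle.dx (C1Circle.pow (u t) p) * C1Circle.dx (u t)))

end

/-! The transport term `uᵖ ∂ₓu` loses a derivative, so the equation is not an ODE in `C¹(𝕋)`. It
becomes one along particle paths. Let `η = id + φ` solve `∂ₜη = uᵖ ∘ η`, `φ(0) = 0`, and put `U = u
∘ η`. Then `∂ₜφ = Uᵖ`, and the transport term cancels from `∂ₜU`, leaving half of `∂ₓ⁻¹(∂ₓ(uᵖ) ∂ₓu)
∘ η`. The substitution `x = η(y)` rewrites this as a weighted primitive of `p Uᵖ⁻¹ (∂U)² / ∂η`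
(`lagrangianField_comp`). No composition is left, and integration recovers the lost derivative, so
the field is `C¹` on `C¹(𝕋) × C¹(𝕋)` wherever `∂η` has no zero (`contDiffAt_lagrangianField`).

Existence: Picard–Lindelöf gives a flow jointly continuous in datum and time, and a short time keeps
`|∂φ| ≤ 1/2` (`exists_lagrangian_flow`). Then `u = U ∘ η⁻¹` solves the equation
(`hasDerivWithinAt_eulerian`) and depends continuously on `(φ, U)` (`continuousOn_eulerian`).
Compactness of `[0, T]` makes the dependence on the data uniform in time.

Uniqueness: the field `uᵖ` of any solution has a `C¹` flow (`exists_flow`), so every solution lifts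
to an integral curve (`hasDerivWithinAt_lagrangian`). Two lifts with the same start agree
(`eqOn_Icc_of_contDiffAt`), and the composition can be undone.

Derivatives in function spaces are found by evaluating at points and then integrating a continuous
candidate (`hasDerivWithinAt_of_forall_clm`). -/

open scoped NNReal

/-! ### The Banach space `C¹(𝕋)` and its multiplication. -/

namespace C1Circle

theorem hasDerivAt (u : C1Circle) (x : ℝ) :
    HasDerivAt (fun y : ℝ => fn u (y : UnitAddCircle)) (dx u (x : UnitAddCircle)) x := u.2 x

/-- Construct an element of `C¹(𝕋)` from a function and its derivative. -/
def mk (f g : C(UnitAddCircle, ℝ)) (h : ∀ x : ℝ, HasDerivAt (fun y : ℝ => f (y : UnitAddCircle))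
    (g (x : UnitAddCircle)) x) : C1Circle := ⟨(f, g), h⟩

@[simp] theorem fn_mk (f g : C(UnitAddCircle, ℝ)) (h) : fn (mk f g h) = f := rfl
@[simp] theorem dx_mk (f g : C(UnitAddCircle, ℝ)) (h) : dx (mk f g h) = g := rfl
@[simp] theorem fn_add (u v : C1Circle) : fn (u + v) = fn u + fn v := rfl
@[simp] theorem dx_add (u v : C1Circle) : dx (u + v) = dx u + dx v := rfl
@[simp] theorem fn_sub (u v : C1Circle) : fn (u - v) = fn u - fn v := rfl
@[simp] theorem dx_sub (u v : C1Circle) : dx (u - v) = dx u - dx v := rfl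
@[simp] theorem fn_smul (c : ℝ) (u : C1Circle) : fn (c • u) = c • fn u := rfl
@[simp] theorem dx_smul (c : ℝ) (u : C1Circle) : dx (c • u) = c • dx u := rfl
@[simp] theorem fn_zero : fn 0 = 0 := rfl
@[simp] theorem dx_zero : dx 0 = 0 := rfl
@[simp] theorem fn_pow (u : C1Circle) (p : ℕ) : fn (pow u p) = fn u ^ p := rfl
@[simp] theorem dx_pow (u : C1Circle) (p : ℕ) :
    dx (pow u p) = (p : ℝ) • (fn u ^ (p - 1) * dx u) := rfl

/-- A `C¹` function is determined by its values. -/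
theorem ext_fn {u v : C1Circle} (h : fn u = fn v) : u = v := by
  refine Subtype.ext (Prod.ext h ?_)
  ext x
  induction x using QuotientAddGroup.induction_on with
  | H x =>
    refine (hasDerivAt u x).unique ?_
    rw [h]
    exact hasDerivAt v x

theorem norm_def (u : C1Circle) : ‖u‖ = max ‖fn u‖ ‖dx u‖ := rfl

/-- `fn` as a continuous linear map. -/
noncomputable def fnL : C1Circle →L[ℝ] C(UnitAddCircle, ℝ) :=
  (ContinuousLinearMap.fst ℝ _ _).comp C1Circle.subtypeL

/-- `dx` as a continuous linear map. -/
noncomputable def dxL : C1Circle →L[ℝ] C(UnitAddCircle, ℝ) :=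
  (ContinuousLinearMap.snd ℝ _ _).comp C1Circle.subtypeL

theorem continuous_fn : Continuous fn := fnL.continuous
theorem continuous_dx : Continuous dx := dxL.continuous

/-- Uniform convergence of functions and derivatives passes to the limit. This gives the
completeness that Picard–Lindelöf needs. -/
theorem isClosed_carrier :
    IsClosed (C1Circle : Set (C(UnitAddCircle, ℝ) × C(UnitAddCircle, ℝ))) := by
  refine IsSeqClosed.isClosed fun s l hs hl x => ?_
  have h1 : TendstoUniformly (fun n => (s n).1) l.1 atTop :=
    ContinuousMap.tendsto_iff_tendstoUniformly.1 ((continuous_fst.tendsto l).comp hl)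
  have h2 : TendstoUniformly (fun n => (s n).2) l.2 atTop :=
    ContinuousMap.tendsto_iff_tendstoUniformly.1 ((continuous_snd.tendsto l).comp hl)
  exact hasDerivAt_of_tendstoUniformly (f := fun n (y : ℝ) => (s n).1 (y : UnitAddCircle))
    (g := fun y : ℝ => l.1 (y : UnitAddCircle)) (f' := fun n (y : ℝ) => (s n).2 (y : UnitAddCircle))
    (g' := fun y : ℝ => l.2 (y : UnitAddCircle))
    (h2.comp (fun y : ℝ => (y : UnitAddCircle)))
    (Eventually.of_forall fun n y => hs n y) (fun y => h1.tendsto_at _) x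

instance : CompleteSpace C1Circle := isClosed_carrier.completeSpace_coe

theorem abs_sub_le (u : C1Circle) (x y : ℝ) :
    |fn u (x : UnitAddCircle) - fn u (y : UnitAddCircle)| ≤ ‖dx u‖ * |x - y| :=
  Convex.norm_image_sub_le_of_norm_hasDerivWithin_le (s := univ) (x := y) (y := x)
    (fun z _ => (hasDerivAt u z).hasDerivWithinAt)
    (fun z _ => (dx u).norm_coe_le_norm z) convex_univ (mem_univ _) (mem_univ _)

/-- The constant function `1`. -/
def one : C1Circle := mk 1 0 fun x => hasDerivAt_const x (1 : ℝ)

@[simp] theorem fn_one : fn one = 1 := rfl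
@[simp] theorem dx_one : dx one = 0 := rfl

/-- Multiplication of `C¹` functions. -/
def mul (u v : C1Circle) : C1Circle :=
  mk (fn u * fn v) (dx u * fn v + fn u * dx v) fun x => (hasDerivAt u x).mul (hasDerivAt v x)

@[simp] theorem fn_mul (u v : C1Circle) : fn (mul u v) = fn u * fn v := rfl
@[simp] theorem dx_mul (u v : C1Circle) : dx (mul u v) = dx u * fn v + fn u * dx v := rfl

theorem norm_fn_le (u : C1Circle) : ‖fn u‖ ≤ ‖u‖ := le_max_left _ _
theorem norm_dx_le (u : C1Circle) : ‖dx u‖ ≤ ‖u‖ := le_max_right _ _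

theorem norm_mul_le_two (u v : C1Circle) : ‖mul u v‖ ≤ 2 * ‖u‖ * ‖v‖ := by
  have h : ∀ a b c d : ℝ, 0 ≤ a → 0 ≤ c → a ≤ b → c ≤ d → a * c ≤ b * d :=
    fun a b c d h1 h2 h3 h4 => mul_le_mul h3 h4 h2 (h1.trans h3)
  have h1 := h _ _ _ _ (norm_nonneg _) (norm_nonneg _) (norm_fn_le u) (norm_fn_le v)
  have h2 := h _ _ _ _ (norm_nonneg _) (norm_nonneg _) (norm_dx_le u) (norm_fn_le v)
  have h3 := h _ _ _ _ (norm_nonneg _) (norm_nonneg _) (norm_fn_le u) (norm_dx_le v)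
  have h4 : 0 ≤ ‖u‖ * ‖v‖ := by positivity
  rw [norm_def (mul u v)]
  refine max_le ?_ ?_
  · rw [fn_mul]
    linarith [norm_mul_le (fn u) (fn v)]
  · rw [dx_mul]
    linarith [norm_add_le (dx u * fn v) (fn u * dx v), norm_mul_le (dx u) (fn v),
      norm_mul_le (fn u) (dx v)]

theorem isBoundedBilinearMap_mul :
    IsBoundedBilinearMap ℝ (fun q : C1Circle × C1Circle => mul q.1 q.2) where
  add_left u v w := ext_fn (by simp [add_mul])
  smul_left c u v := ext_fn (by simp)
  add_right u v w := ext_fn (by simp [mul_add])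
  smul_right c u v := ext_fn (by simp)
  bound := ⟨2, by norm_num, norm_mul_le_two⟩

theorem pow_succ (u : C1Circle) (p : ℕ) : pow u (p + 1) = mul (pow u p) u :=
  ext_fn (by simp [_root_.pow_succ])

theorem contDiff_pow (p : ℕ) {n : WithTop ℕ∞} : ContDiff ℝ n (fun u => pow u p) := by
  induction p with
  | zero =>
    have : (fun u => pow u 0) = fun _ => one := funext fun u => ext_fn (by simp)
    rw [this]
    exact contDiff_const
  | succ p ih =>
    simp only [pow_succ]
    have h : ContDiff ℝ n (fun q : C1Circle × C1Circle => mul q.1 q.2) :=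
      isBoundedBilinearMap_mul.contDiff
    exact h.comp (ih.prodMk contDiff_id)

theorem continuous_pow (p : ℕ) : Continuous (fun u => pow u p) :=
  (contDiff_pow p (n := 0)).continuous

end C1Circle

/-! ### Means and the operator `∂ₓ⁻¹`. -/

/-- The mean value of a continuous function on the circle. -/
noncomputable def circleMean : C(UnitAddCircle, ℝ) →L[ℝ] ℝ :=
  LinearMap.mkContinuous
    { toFun := fun f => ∫ z : UnitAddCircle, f z
      map_add' := fun f g => integral_add
        (f.continuous.integrable_of_hasCompactSupport (HasCompactSupport.of_compactSpace f))
        (g.continuous.integrable_of_hasCompactSupport (HasCompactSupport.of_compactSpace g))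
      map_smul' := fun c f => integral_const_mul c _ } 1 fun f => by
    have := norm_integral_le_of_norm_le_const (μ := (volume : Measure UnitAddCircle))
      (Eventually.of_forall f.norm_coe_le_norm)
    simpa [Measure.real] using this

theorem circleMean_apply (f : C(UnitAddCircle, ℝ)) : circleMean f = ∫ z : UnitAddCircle, f z := rfl

theorem circleMean_eq_intervalIntegral (f : C(UnitAddCircle, ℝ)) (a : ℝ) :
    circleMean f = ∫ y in a..(a + 1), f (y : UnitAddCircle) :=
  (UnitAddCircle.intervalIntegral_preimage a (fun z => f z)).symm

@[simp] theorem circleMean_one : circleMean 1 = 1 := by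
  simp [circleMean_apply, Measure.real]

theorem circleMean_smul_one (c : ℝ) : circleMean (c • 1) = c := by
  simp

theorem norm_circleMean_le (f : C(UnitAddCircle, ℝ)) : |circleMean f| ≤ ‖f‖ := by
  have := norm_integral_le_of_norm_le_const (μ := (volume : Measure UnitAddCircle))
      (Eventually.of_forall f.norm_coe_le_norm)
  simpa [Measure.real, circleMean_apply] using this

theorem continuous_coe_circle (f : C(UnitAddCircle, ℝ)) :
    Continuous fun y : ℝ => f (y : UnitAddCircle) :=
  f.continuous.comp (AddCircle.continuous_mk' 1)

namespace C1Circle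

/-- The derivative of a periodic function has mean zero. -/
theorem circleMean_dx (u : C1Circle) : circleMean (dx u) = 0 := by
  rw [circleMean_eq_intervalIntegral _ 0, intervalIntegral.integral_eq_sub_of_hasDerivAt
    (fun x _ => hasDerivAt u x) ((continuous_coe_circle _).intervalIntegrable _ _)]
  have h : ((0 + 1 : ℝ) : UnitAddCircle) = ((0 : ℝ) : UnitAddCircle) := by
    simp
  rw [h, sub_self]

theorem eq_smul_one_of_dx_eq_zero {u : C1Circle} (h : dx u = 0) : u = (fn u 0) • one := by
  refine ext_fn ?_
  ext x
  induction x using QuotientAddGroup.induction_on with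
  | H x =>
    have := abs_sub_le u x 0
    rw [h, norm_zero, zero_mul] at this
    have h2 := sub_eq_zero.1 (abs_nonpos_iff.1 this)
    rw [AddCircle.coe_zero] at h2
    simpa using h2

/-- A `C¹` function is determined by its derivative and a weighted mean. -/
theorem eq_of_dx_eq {u v : C1Circle} {w : C(UnitAddCircle, ℝ)} (hw : circleMean w = 1)
    (h : dx u = dx v) (hm : circleMean (fn u * w) = circleMean (fn v * w)) : u = v := by
  have h0 : dx (u - v) = 0 := by simp [h]
  have h1 := eq_smul_one_of_dx_eq_zero h0
  have h2 : circleMean (fn (u - v) * w) = 0 := by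
    rw [fn_sub, sub_mul, map_sub, hm, sub_self]
  rw [h1, fn_smul, fn_one, smul_mul_assoc, one_mul, map_smul, hw] at h2
  rw [← sub_eq_zero, h1]
  have h3 : fn (u - v) 0 = 0 := by simpa using h2
  rw [h3, zero_smul]

/-- With zero mean, `u(x)` is the integral of `u(x) - u(y)` over the period `[x, x + 1]`, where `|x
- y| ≤ 1`. -/
theorem norm_fn_le_of_circleMean_eq_zero {u : C1Circle} (h : circleMean (fn u) = 0) :
    ‖fn u‖ ≤ ‖dx u‖ := by
  refine (ContinuousMap.norm_le _ (norm_nonneg _)).2 fun x => ?_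
  induction x using QuotientAddGroup.induction_on with
  | H x =>
    have h1 : ∫ y in x..(x + 1), (fn u (x : UnitAddCircle) - fn u (y : UnitAddCircle)) =
        fn u (x : UnitAddCircle) := by
      rw [intervalIntegral.integral_sub intervalIntegrable_const
        ((continuous_coe_circle _).intervalIntegrable _ _), ← circleMean_eq_intervalIntegral, h]
      simp
    have h2 := intervalIntegral.norm_integral_le_of_norm_le_const (a := x) (b := x + 1)
      (C := ‖dx u‖) (f := fun y => fn u (x : UnitAddCircle) - fn u (y : UnitAddCircle))
      fun y hy => by
        rw [uIoc_of_le (by linarith)] at hy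
        refine (abs_sub_le u x y).trans (mul_le_of_le_one_right (norm_nonneg _) ?_)
        rw [abs_le]
        constructor <;> linarith [hy.1, hy.2]
    rw [h1] at h2
    simpa using h2

end C1Circle

theorem hasDerivAt_dxInv (x₀ : ℝ) (f : C(UnitAddCircle, ℝ)) (x : ℝ) :
    HasDerivAt (fun y : ℝ => dxInv x₀ f (y : UnitAddCircle))
      ((f - circleMean f • (1 : C(UnitAddCircle, ℝ))) (x : UnitAddCircle)) x := by
  have h := (continuous_sub_mean f).integral_hasStrictDerivAt x₀ x
  have h2 := h.hasDerivAt.sub_const (∫ x : UnitAddCircle, circlePrimitive x₀ f x)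
  have e : (f - circleMean f • (1 : C(UnitAddCircle, ℝ))) (x : UnitAddCircle) =
      f (x : UnitAddCircle) - ∫ z : UnitAddCircle, f z := by
    simp [circleMean_apply]
  rw [e]
  exact h2

theorem circleMean_dxInv (x₀ : ℝ) (f : C(UnitAddCircle, ℝ)) : circleMean (dxInv x₀ f) = 0 := by
  have : dxInv x₀ f = circlePrimitive x₀ f - circleMean (circlePrimitive x₀ f) • 1 := by
    ext x
    simp [dxInv, circleMean_apply]
  rw [this, map_sub, circleMean_smul_one, sub_self]

/-- `∂ₓ⁻¹` as a map into `C¹(𝕋)`. -/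
noncomputable def dxInvC1 (x₀ : ℝ) (f : C(UnitAddCircle, ℝ)) : C1Circle :=
  C1Circle.mk (dxInv x₀ f) (f - circleMean f • 1) (hasDerivAt_dxInv x₀ f)

@[simp] theorem fn_dxInvC1 (x₀ : ℝ) (f : C(UnitAddCircle, ℝ)) :
    C1Circle.fn (dxInvC1 x₀ f) = dxInv x₀ f := rfl
@[simp] theorem dx_dxInvC1 (x₀ : ℝ) (f : C(UnitAddCircle, ℝ)) :
    C1Circle.dx (dxInvC1 x₀ f) = f - circleMean f • 1 := rfl

/-- `∂ₓ⁻¹` as a continuous linear map into `C¹(𝕋)`. -/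
noncomputable def dxInvL (x₀ : ℝ) : C(UnitAddCircle, ℝ) →L[ℝ] C1Circle :=
  LinearMap.mkContinuous
    { toFun := dxInvC1 x₀
      map_add' := fun f g => C1Circle.eq_of_dx_eq circleMean_one
        (by simp [add_smul]; abel) (by simp [circleMean_dxInv])
      map_smul' := fun c f => C1Circle.eq_of_dx_eq circleMean_one
        (by simp [smul_sub, mul_smul]) (by simp [circleMean_dxInv]) } 2 fun f => by
    have h1 : ‖f - circleMean f • (1 : C(UnitAddCircle, ℝ))‖ ≤ 2 * ‖f‖ := by
      refine (norm_sub_le _ _).trans ?_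
      rw [norm_smul, norm_one, mul_one, Real.norm_eq_abs]
      linarith [norm_circleMean_le f]
    exact max_le ((C1Circle.norm_fn_le_of_circleMean_eq_zero
      (u := dxInvC1 x₀ f) (circleMean_dxInv x₀ f)).trans h1) h1

theorem continuous_dxInv (x₀ : ℝ) : Continuous (dxInv x₀) :=
  C1Circle.continuous_fn.comp (dxInvL x₀).continuous

/-! ### Composition with `id + φ`. -/

/-- Composition `f ∘ (id + φ)` of functions on the circle. -/
def shiftComp (f φ : C(UnitAddCircle, ℝ)) : C(UnitAddCircle, ℝ) :=
  ⟨fun x => f (x + ((φ x : ℝ) : UnitAddCircle)),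
    f.continuous.comp (continuous_id.add ((AddCircle.continuous_mk' 1).comp φ.continuous))⟩

theorem shiftComp_apply (f φ : C(UnitAddCircle, ℝ)) (x : UnitAddCircle) :
    shiftComp f φ x = f (x + ((φ x : ℝ) : UnitAddCircle)) := rfl

theorem shiftComp_coe (f φ : C(UnitAddCircle, ℝ)) (x : ℝ) :
    shiftComp f φ (x : UnitAddCircle) = f ((x + φ (x : UnitAddCircle) : ℝ) : UnitAddCircle) := by
  rw [shiftComp_apply, AddCircle.coe_add]

theorem continuous_shiftComp : Continuous
    (fun q : C(UnitAddCircle, ℝ) × C(UnitAddCircle, ℝ) => shiftComp q.1 q.2) := by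
  refine ContinuousMap.continuous_of_continuous_uncurry _ ?_
  have h : Continuous fun a : (C(UnitAddCircle, ℝ) × C(UnitAddCircle, ℝ)) × UnitAddCircle =>
      a.2 + ((a.1.2 a.2 : ℝ) : UnitAddCircle) :=
    continuous_snd.add ((AddCircle.continuous_mk' 1).comp (by fun_prop))
  exact (continuous_fst.fst : Continuous fun
    a : (C(UnitAddCircle, ℝ) × C(UnitAddCircle, ℝ)) × UnitAddCircle => a.1.1).eval h

@[simp] theorem sub_shiftComp (f g φ : C(UnitAddCircle, ℝ)) :
    shiftComp (f - g) φ = shiftComp f φ - shiftComp g φ := rfl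
@[simp] theorem mul_shiftComp (f g φ : C(UnitAddCircle, ℝ)) :
    shiftComp (f * g) φ = shiftComp f φ * shiftComp g φ := rfl
@[simp] theorem smul_shiftComp (c : ℝ) (f φ : C(UnitAddCircle, ℝ)) :
    shiftComp (c • f) φ = c • shiftComp f φ := rfl
@[simp] theorem one_shiftComp (φ : C(UnitAddCircle, ℝ)) : shiftComp 1 φ = 1 := rfl
@[simp] theorem pow_shiftComp (f φ : C(UnitAddCircle, ℝ)) (n : ℕ) :
    shiftComp (f ^ n) φ = shiftComp f φ ^ n := by
  ext x
  simp [shiftComp_apply]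

theorem norm_shiftComp_le (f φ : C(UnitAddCircle, ℝ)) : ‖shiftComp f φ‖ ≤ ‖f‖ :=
  (ContinuousMap.norm_le _ (norm_nonneg _)).2 fun _ => f.norm_coe_le_norm _

/-- Lipschitz dependence on the inner function costs one derivative of the outer one. -/
theorem norm_shiftComp_sub_le (u : C1Circle) (φ θ : C(UnitAddCircle, ℝ)) :
    ‖shiftComp (C1Circle.fn u) φ - shiftComp (C1Circle.fn u) θ‖ ≤
      ‖C1Circle.dx u‖ * ‖φ - θ‖ := by
  refine (ContinuousMap.norm_le _ (by positivity)).2 fun x => ?_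
  induction x using QuotientAddGroup.induction_on with
  | H x =>
    have h : |φ (x : UnitAddCircle) - θ (x : UnitAddCircle)| ≤ ‖φ - θ‖ :=
      (φ - θ).norm_coe_le_norm x
    have h1 := C1Circle.abs_sub_le u (x + φ (x : UnitAddCircle)) (x + θ (x : UnitAddCircle))
    rw [add_sub_add_left_eq_sub] at h1
    rw [ContinuousMap.sub_apply, Real.norm_eq_abs]
    simp only [shiftComp_coe]
    exact h1.trans (mul_le_mul_of_nonneg_left h (norm_nonneg _))

/-- The map `id + φ` is onto. -/
theorem surjective_add_coe (φ : C(UnitAddCircle, ℝ)) :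
    Function.Surjective fun x : ℝ => x + φ (x : UnitAddCircle) := by
  have hb : ∀ x : ℝ, |φ (x : UnitAddCircle)| ≤ ‖φ‖ := fun x => φ.norm_coe_le_norm x
  refine (continuous_id.add (continuous_coe_circle φ)).surjective ?_ ?_
  · exact tendsto_atTop_add_right_of_le _ (-‖φ‖) tendsto_id fun x => (abs_le.1 (hb x)).1
  · exact tendsto_atBot_add_right_of_ge _ ‖φ‖ tendsto_id fun x => (abs_le.1 (hb x)).2

/-- Surjectivity of `id + φ` suffices; no inverse is needed. -/
theorem shiftComp_injective (φ : C(UnitAddCircle, ℝ)) :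
    Function.Injective fun f => shiftComp f φ := by
  intro f g h
  ext x
  induction x using QuotientAddGroup.induction_on with
  | H x =>
    obtain ⟨y, rfl⟩ := surjective_add_coe φ x
    have := DFunLike.congr_fun h (y : UnitAddCircle)
    simpa only [shiftComp_coe] using this

namespace C1Circle

/-- Composition `u ∘ (id + φ)` of `C¹` functions. -/
def comp (u φ : C1Circle) : C1Circle :=
  mk (shiftComp (fn u) (fn φ)) (shiftComp (dx u) (fn φ) * (1 + dx φ)) fun x => by
    have h := (hasDerivAt u (x + fn φ (x : UnitAddCircle))).comp x
      ((hasDerivAt_id x).add (hasDerivAt φ x))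
    simp only [ContinuousMap.mul_apply, shiftComp_coe]
    exact h

@[simp] theorem fn_comp (u φ : C1Circle) : fn (comp u φ) = shiftComp (fn u) (fn φ) := rfl
@[simp] theorem dx_comp (u φ : C1Circle) :
    dx (comp u φ) = shiftComp (dx u) (fn φ) * (1 + dx φ) := rfl

theorem continuous_comp : Continuous fun q : C1Circle × C1Circle => comp q.1 q.2 := by
  have h1 : Continuous fun q : C1Circle × C1Circle => shiftComp (fn q.1) (fn q.2) :=
    continuous_shiftComp.comp ((continuous_fn.comp continuous_fst).prodMk
      (continuous_fn.comp continuous_snd))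
  have h2 : Continuous fun q : C1Circle × C1Circle => shiftComp (dx q.1) (fn q.2) :=
    continuous_shiftComp.comp ((continuous_dx.comp continuous_fst).prodMk
      (continuous_fn.comp continuous_snd))
  exact (h1.prodMk (h2.mul (continuous_const.add
    (continuous_dx.comp continuous_snd)))).subtype_mk _

theorem circleMean_one_add_dx (φ : C1Circle) : circleMean (1 + dx φ) = 1 := by
  rw [map_add, circleMean_dx, circleMean_one, add_zero]

/-- Change of variables `x = y + φ(y)` on the circle. -/
theorem circleMean_shiftComp_mul (f : C(UnitAddCircle, ℝ)) (φ : C1Circle) :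
    circleMean (shiftComp f (fn φ) * (1 + dx φ)) = circleMean f := by
  -- The derivative of the periodic function `∂ₓ⁻¹f ∘ (id + φ)` has mean zero. This gives the
  -- formula without monotonicity of `id + φ`.
  have h := circleMean_dx (comp (dxInvC1 0 f) φ)
  rw [dx_comp, dx_dxInvC1, sub_shiftComp, sub_mul, map_sub, smul_shiftComp, one_shiftComp,
    smul_mul_assoc, one_mul, map_smul, circleMean_one_add_dx] at h
  simpa [sub_eq_zero] using h

end C1Circle

/-! ### Inverting `id + φ` and returning to Eulerian coordinates. -/

theorem ring_inverse_apply {f : C(UnitAddCircle, ℝ)} (hf : IsUnit f) (x : UnitAddCircle) :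
    Ring.inverse f x = (f x)⁻¹ := by
  have h := DFunLike.congr_fun (Ring.inverse_mul_cancel f hf) x
  exact eq_inv_of_mul_eq_one_left h

namespace C1Circle

theorem half_le_one_add_dx {φ : C1Circle} (h : ‖dx φ‖ ≤ 1 / 2) (x : UnitAddCircle) :
    1 / 2 ≤ (1 + dx φ) x := by
  have h1 := ((dx φ).norm_coe_le_norm x).trans h
  have h2 := (abs_le.1 h1).1
  have h3 : (1 + dx φ) x = 1 + dx φ x := rfl
  rw [h3]
  linarith

theorem isUnit_one_add_dx {φ : C1Circle} (h : ‖dx φ‖ ≤ 1 / 2) : IsUnit (1 + dx φ) := by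
  rw [ContinuousMap.isUnit_iff_forall_ne_zero]
  intro x hx
  have := half_le_one_add_dx h x
  rw [hx] at this
  norm_num at this

/-- The equation says `(id + φ) ∘ (id + θ) = id`; `θ` is the fixed point of a `1/2`-contraction of
`C⁰`. The hypothesis sits under the quantifier so that `θ` can be chosen for every `φ`. -/
theorem exists_shift_inverse (φ : C1Circle) :
    ∃ θ : C(UnitAddCircle, ℝ), ‖dx φ‖ ≤ 1 / 2 → θ = -shiftComp (fn φ) θ := by
  by_cases h : ‖dx φ‖ ≤ 1 / 2
  · have hc : ContractingWith (1 / 2) fun θ => -shiftComp (fn φ) θ := by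
      refine ⟨by rw [← NNReal.coe_lt_coe]; norm_num, LipschitzWith.of_dist_le_mul fun a b => ?_⟩
      rw [dist_neg_neg, dist_eq_norm, dist_eq_norm]
      refine (norm_shiftComp_sub_le φ a b).trans (mul_le_mul_of_nonneg_right ?_ (norm_nonneg _))
      simpa using h
    exact ⟨_, fun _ => hc.fixedPoint_isFixedPt.symm⟩
  · exact ⟨0, fun h' => absurd h' h⟩

/-- The function `θ` such that `id + θ` is the inverse of `id + φ`. -/
noncomputable def shiftInv (φ : C1Circle) : C(UnitAddCircle, ℝ) := (exists_shift_inverse φ).choose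

theorem shiftInv_eq {φ : C1Circle} (h : ‖dx φ‖ ≤ 1 / 2) :
    shiftInv φ = -shiftComp (fn φ) (shiftInv φ) := (exists_shift_inverse φ).choose_spec h

theorem shiftInv_coe {φ : C1Circle} (h : ‖dx φ‖ ≤ 1 / 2) (x : ℝ) :
    (x + shiftInv φ (x : UnitAddCircle)) +
      fn φ ((x + shiftInv φ (x : UnitAddCircle) : ℝ) : UnitAddCircle) = x := by
  have h1 := DFunLike.congr_fun (shiftInv_eq h) (x : UnitAddCircle)
  rw [ContinuousMap.neg_apply, shiftComp_coe] at h1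
  linarith

/-- Subtract the two fixed point equations. Half of the left side reappears on the right, and
absorbing it produces the factor `2`. -/
theorem norm_shiftInv_sub_le {φ χ : C1Circle} (h : ‖dx φ‖ ≤ 1 / 2) (h' : ‖dx χ‖ ≤ 1 / 2) :
    ‖shiftInv φ - shiftInv χ‖ ≤ 2 * ‖φ - χ‖ := by
  have h1 : shiftInv φ - shiftInv χ =
      (shiftComp (fn φ) (shiftInv χ) - shiftComp (fn φ) (shiftInv φ)) -
        shiftComp (fn (φ - χ)) (shiftInv χ) := by
    rw [fn_sub, sub_shiftComp]
    nth_rw 1 [shiftInv_eq h, shiftInv_eq h']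
    abel
  have h2 := norm_sub_le
    (shiftComp (fn φ) (shiftInv χ) - shiftComp (fn φ) (shiftInv φ))
    (shiftComp (fn (φ - χ)) (shiftInv χ))
  rw [← h1] at h2
  have h3 := norm_shiftComp_sub_le φ (shiftInv χ) (shiftInv φ)
  have h4 := (norm_shiftComp_le (fn (φ - χ)) (shiftInv χ)).trans (norm_fn_le _)
  have h5 := mul_le_mul_of_nonneg_right h (norm_nonneg (shiftInv χ - shiftInv φ))
  rw [norm_sub_rev (shiftInv χ)] at h3 h5
  linarith

theorem continuousOn_shiftInv : ContinuousOn shiftInv {φ | ‖dx φ‖ ≤ 1 / 2} :=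
  LipschitzOnWith.continuousOn (K := 2) <| LipschitzOnWith.of_dist_le_mul fun φ h χ h' => by
    rw [dist_eq_norm, dist_eq_norm]
    exact norm_shiftInv_sub_le h h'

/-- By construction `id + θ` is only a right inverse of `id + φ`. It is also a left inverse because
`id + φ` is injective: points with equal image satisfy `|y - z| ≤ |y - z| / 2`. -/
theorem shiftComp_shiftInv_shiftComp {φ : C1Circle} (h : ‖dx φ‖ ≤ 1 / 2)
    (f : C(UnitAddCircle, ℝ)) : shiftComp (shiftComp f (shiftInv φ)) (fn φ) = f := by
  ext y
  induction y using QuotientAddGroup.induction_on with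
  | H y =>
    rw [shiftComp_coe, shiftComp_coe]
    congr 2
    set x := y + fn φ (y : UnitAddCircle) with hx
    set z := x + shiftInv φ (x : UnitAddCircle) with hz
    have h1 : z + fn φ (z : UnitAddCircle) = x := shiftInv_coe h x
    have h2 := abs_sub_le φ y z
    have h3 : fn φ (y : UnitAddCircle) - fn φ (z : UnitAddCircle) = z - y := by linarith
    rw [h3, abs_sub_comm] at h2
    have h4 := mul_le_mul_of_nonneg_right h (abs_nonneg (y - z))
    have h5 : |y - z| ≤ 0 := by linarith
    have := sub_eq_zero.1 (abs_nonpos_iff.1 h5)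
    exact this.symm

/-- The function `U ∘ (id + φ)⁻¹`, where it makes sense. -/
noncomputable def eulerian (φ U : C1Circle) : C1Circle :=
  if h : ‖dx φ‖ ≤ 1 / 2 then
    mk (shiftComp (fn U) (shiftInv φ))
      (shiftComp (dx U * Ring.inverse (1 + dx φ)) (shiftInv φ)) fun x => by
    set z := x + shiftInv φ (x : UnitAddCircle) with hz
    have hpos := half_le_one_add_dx h (z : UnitAddCircle)
    have h1 : HasDerivAt (fun y : ℝ => y + shiftInv φ (y : UnitAddCircle))
        ((1 + dx φ) (z : UnitAddCircle))⁻¹ x := by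
      refine HasDerivAt.of_local_left_inverse
        (f := fun y : ℝ => y + fn φ (y : UnitAddCircle)) ?_ ?_ (by linarith)
        (Eventually.of_forall fun y => shiftInv_coe h y)
      · exact (continuous_id.add (continuous_coe_circle _)).continuousAt
      · exact (hasDerivAt_id z).add (hasDerivAt φ z)
    have h2 := (hasDerivAt U z).comp x h1
    simp only [shiftComp_coe]
    rw [ContinuousMap.mul_apply, ring_inverse_apply (isUnit_one_add_dx h)]
    exact h2
  else 0

theorem fn_eulerian {φ : C1Circle} (h : ‖dx φ‖ ≤ 1 / 2) (U : C1Circle) :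
    fn (eulerian φ U) = shiftComp (fn U) (shiftInv φ) := by
  rw [eulerian, dif_pos h, fn_mk]

theorem dx_eulerian {φ : C1Circle} (h : ‖dx φ‖ ≤ 1 / 2) (U : C1Circle) :
    dx (eulerian φ U) = shiftComp (dx U * Ring.inverse (1 + dx φ)) (shiftInv φ) := by
  rw [eulerian, dif_pos h, dx_mk]

theorem comp_eulerian {φ : C1Circle} (h : ‖dx φ‖ ≤ 1 / 2) (U : C1Circle) :
    comp (eulerian φ U) φ = U := by
  refine ext_fn ?_
  rw [fn_comp, fn_eulerian h, shiftComp_shiftInv_shiftComp h]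

theorem continuousOn_iff {α : Type*} [TopologicalSpace α] {f : α → C1Circle} {s : Set α} :
    ContinuousOn f s ↔ ContinuousOn (fun a => fn (f a)) s ∧ ContinuousOn (fun a => dx (f a)) s := by
  refine ⟨fun h => ⟨continuous_fn.comp_continuousOn h, continuous_dx.comp_continuousOn h⟩,
    fun h => ?_⟩
  rw [Topology.IsInducing.subtypeVal.continuousOn_iff]
  exact h.1.prodMk h.2

theorem continuousOn_ring_inverse {α : Type*} [TopologicalSpace α] {f : α → C(UnitAddCircle, ℝ)}
    {s : Set α} (hf : ContinuousOn f s) (hu : ∀ a ∈ s, IsUnit (f a)) :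
    ContinuousOn (fun a => Ring.inverse (f a)) s := by
  intro a ha
  obtain ⟨u, hu⟩ := hu a ha
  have h := NormedRing.inverse_continuousAt u
  rw [hu] at h
  exact h.comp_continuousWithinAt (f := f) (hf a ha)

/-- Both components are built from the jointly continuous `shiftComp`, the inverse shift, and
inversion in a Banach algebra. Only continuity is obtained, hence continuous and not Lipschitz
dependence on the data. -/
theorem continuousOn_eulerian :
    ContinuousOn (fun q : C1Circle × C1Circle => eulerian q.1 q.2) {q | ‖dx q.1‖ ≤ 1 / 2} := by
  have h0 : ContinuousOn (fun q : C1Circle × C1Circle => shiftInv q.1) {q | ‖dx q.1‖ ≤ 1 / 2} :=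
    continuousOn_shiftInv.comp continuousOn_fst fun q hq => hq
  have h1 : Continuous fun q : C1Circle × C1Circle => 1 + dx q.1 :=
    continuous_const.add (continuous_dx.comp continuous_fst)
  refine continuousOn_iff.2 ⟨?_, ?_⟩
  · refine ContinuousOn.congr (f := fun q : C1Circle × C1Circle => shiftComp (fn q.2) (shiftInv q.1))
      ?_ fun q hq => fn_eulerian hq q.2
    exact continuous_shiftComp.comp_continuousOn
      ((continuous_fn.comp continuous_snd).continuousOn.prodMk h0)
  · refine ContinuousOn.congr (f := fun q : C1Circle × C1Circle =>
      shiftComp (dx q.2 * Ring.inverse (1 + dx q.1)) (shiftInv q.1))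
      ?_ fun q hq => dx_eulerian hq q.2
    exact continuous_shiftComp.comp_continuousOn
      (((continuous_dx.comp continuous_snd).continuousOn.mul
        (continuousOn_ring_inverse h1.continuousOn fun q hq => isUnit_one_add_dx hq)).prodMk h0)

end C1Circle

/-! ### The equation as a vector field in Lagrangian coordinates. -/

namespace C1Circle

/-- `∂ₓ(uᵖ) ∂ₓu`. -/
noncomputable def force (p : ℕ) (u : C1Circle) : C(UnitAddCircle, ℝ) := dx (pow u p) * dx u

/-- The time derivative prescribed by the equation. -/
noncomputable def mhsRhs (p : ℕ) (x₀ : ℝ) (u : C1Circle) : C(UnitAddCircle, ℝ) :=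
  (1 / 2 : ℝ) • dxInv x₀ (force p u) - fn u ^ p * dx u

theorem continuous_force (p : ℕ) : Continuous (force p) :=
  (continuous_dx.comp (continuous_pow p)).mul continuous_dx

theorem continuous_mhsRhs (p : ℕ) (x₀ : ℝ) : Continuous (mhsRhs p x₀) := by
  have h1 : Continuous fun u => (1 / 2 : ℝ) • dxInv x₀ (force p u) :=
    ((continuous_dxInv x₀).comp (continuous_force p)).const_smul (1 / 2 : ℝ)
  exact h1.sub ((continuous_fn.pow p).mul continuous_dx)

/-- The primitive of the mean zero part of `k` with respect to the weight `1 + ∂ₓφ`. -/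
noncomputable def weightedPrimitive (x₀ : ℝ) (φ : C1Circle) (k : C(UnitAddCircle, ℝ)) : C1Circle :=
  dxInvC1 x₀ (k - circleMean k • (1 + dx φ)) -
    circleMean (dxInv x₀ (k - circleMean k • (1 + dx φ)) * (1 + dx φ)) • one

/-- `∂ₓ⁻¹` in the coordinate `y` with `x = y + φ(y)`. -/
theorem weightedPrimitive_shiftComp (x₀ : ℝ) (φ : C1Circle) (f : C(UnitAddCircle, ℝ)) :
    weightedPrimitive x₀ φ (shiftComp f (fn φ) * (1 + dx φ)) = comp (dxInvC1 x₀ f) φ := by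
  have hw := circleMean_one_add_dx φ
  -- Both sides have the same derivative and zero mean for the weight `1 + ∂ₓφ`, whose total mass is
  -- `1`.
  refine eq_of_dx_eq hw ?_ ?_
  · rw [weightedPrimitive, dx_sub, dx_dxInvC1, dx_smul, dx_one, smul_zero, sub_zero, map_sub,
      map_smul, hw, circleMean_shiftComp_mul, dx_comp, dx_dxInvC1, sub_shiftComp, smul_shiftComp,
      one_shiftComp, smul_eq_mul, mul_one, sub_self, zero_smul, sub_zero, sub_mul, smul_mul_assoc,
      one_mul]
  · rw [weightedPrimitive, fn_sub, sub_mul, map_sub, fn_dxInvC1, fn_smul, fn_one, smul_mul_assoc,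
      one_mul, map_smul, hw, smul_eq_mul, mul_one, sub_self, fn_comp, circleMean_shiftComp_mul,
      fn_dxInvC1, circleMean_dxInv]

/-- The force in Lagrangian coordinates `(φ, U)`, `U = u ∘ (id + φ)`, times the Jacobian. -/
noncomputable def lagrangianForce (p : ℕ) (q : C1Circle × C1Circle) : C(UnitAddCircle, ℝ) :=
  (p : ℝ) • (fn q.2 ^ (p - 1) * dx q.2 ^ 2 * Ring.inverse (1 + dx q.1))

/-- The equation in Lagrangian coordinates, as a vector field. -/
noncomputable def lagrangianField (p : ℕ) (x₀ : ℝ) (q : C1Circle × C1Circle) :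
    C1Circle × C1Circle :=
  (pow q.2 p, (1 / 2 : ℝ) • weightedPrimitive x₀ q.1 (lagrangianForce p q))

/-- The square of `∂U = (∂ₓu ∘ η) ∂η` carries two Jacobian factors; the inverse removes one, and the
other is the weight. -/
theorem lagrangianForce_comp (p : ℕ) {φ : C1Circle} (h : IsUnit (1 + dx φ)) (u : C1Circle) :
    lagrangianForce p (φ, comp u φ) = shiftComp (force p u) (fn φ) * (1 + dx φ) := by
  have h1 := Ring.mul_inverse_cancel _ h
  simp only [lagrangianForce, force, fn_comp, dx_comp, dx_pow, mul_shiftComp, smul_shiftComp,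
    pow_shiftComp, smul_mul_assoc]
  congr 1
  linear_combination (shiftComp (fn u) (fn φ) ^ (p - 1) * shiftComp (dx u) (fn φ) ^ 2 *
    (1 + dx φ)) * h1

theorem lagrangianField_comp (p : ℕ) (x₀ : ℝ) {φ : C1Circle} (h : IsUnit (1 + dx φ))
    (u : C1Circle) : lagrangianField p x₀ (φ, comp u φ) =
      (comp (pow u p) φ, (1 / 2 : ℝ) • comp (dxInvC1 x₀ (force p u)) φ) := by
  refine Prod.ext (ext_fn ?_) ?_
  · simp [lagrangianField]
  · simp only [lagrangianField]
    rw [lagrangianForce_comp p h, weightedPrimitive_shiftComp]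

theorem contDiff_fn {n : WithTop ℕ∞} : ContDiff ℝ n fn := by
  have h : ContDiff ℝ n fun u => fnL u := by fun_prop
  exact h

theorem contDiff_dx {n : WithTop ℕ∞} : ContDiff ℝ n dx := by
  have h : ContDiff ℝ n fun u => dxL u := by fun_prop
  exact h

theorem contDiff_dxInvC1 (x₀ : ℝ) {n : WithTop ℕ∞} : ContDiff ℝ n (dxInvC1 x₀) := by
  have h : ContDiff ℝ n fun u => dxInvL x₀ u := by fun_prop
  exact h

theorem continuous_dxInvC1 (x₀ : ℝ) : Continuous (dxInvC1 x₀) :=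
  (contDiff_dxInvC1 x₀ (n := 0)).continuous

/-- Only products, bounded linear maps and inversion in the Banach algebra `C⁰(𝕋)` occur, all smooth
where `1 + ∂ₓφ` is a unit. -/
theorem contDiffAt_lagrangianField (p : ℕ) (x₀ : ℝ) {q : C1Circle × C1Circle}
    (h : IsUnit (1 + dx q.1)) : ContDiffAt ℝ 1 (lagrangianField p x₀) q := by
  have h1 : ContDiffAt ℝ 1 (fun q : C1Circle × C1Circle => fn q.2) q :=
    contDiff_fn.contDiffAt.comp q contDiffAt_snd
  have h2 : ContDiffAt ℝ 1 (fun q : C1Circle × C1Circle => dx q.2) q :=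
    contDiff_dx.contDiffAt.comp q contDiffAt_snd
  have h3 : ContDiffAt ℝ 1 (fun q : C1Circle × C1Circle => 1 + dx q.1) q :=
    contDiffAt_const.add (contDiff_dx.contDiffAt.comp q contDiffAt_fst)
  have h4 : ContDiffAt ℝ 1 (fun q : C1Circle × C1Circle => Ring.inverse (1 + dx q.1)) q := by
    obtain ⟨w, hw⟩ := h
    have := contDiffAt_ringInverse ℝ (n := 1) w
    rw [hw] at this
    exact this.comp q h3
  have h5 : ContDiffAt ℝ 1 (lagrangianForce p) q :=
    (((h1.pow _).mul (h2.pow 2)).mul h4).const_smul (p : ℝ)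
  have h6 : ContDiffAt ℝ 1 (fun q : C1Circle × C1Circle => lagrangianForce p q -
      circleMean (lagrangianForce p q) • (1 + dx q.1)) q :=
    h5.sub ((circleMean.contDiff.contDiffAt.comp q h5).smul h3)
  have h7 : ContDiffAt ℝ 1 (fun q : C1Circle × C1Circle => dxInvC1 x₀ (lagrangianForce p q -
      circleMean (lagrangianForce p q) • (1 + dx q.1))) q :=
    (contDiff_dxInvC1 x₀).contDiffAt.comp q h6
  have hs : ContDiff ℝ 1 fun c : ℝ => c • one := by
    have h : ContDiff ℝ 1 fun c : ℝ => (ContinuousLinearMap.id ℝ ℝ).smulRight one c := by fun_prop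
    exact h
  have h8 : ContDiffAt ℝ 1 (fun q : C1Circle × C1Circle => circleMean (dxInv x₀ (lagrangianForce p q -
      circleMean (lagrangianForce p q) • (1 + dx q.1)) * (1 + dx q.1)) • one) q :=
    hs.contDiffAt.comp q (circleMean.contDiff.contDiffAt.comp q
      ((contDiff_fn.contDiffAt.comp q h7).mul h3))
  have h9 : ContDiff ℝ 1 fun u : C1Circle => (1 / 2 : ℝ) • u := contDiff_id.const_smul (1 / 2 : ℝ)
  exact ((contDiff_pow p).contDiffAt.comp q contDiffAt_snd).prodMk
    (h9.contDiffAt.comp q (h7.sub h8))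

end C1Circle

/-! ### General tools: weak differentiation, ODE uniqueness, uniformity on compacts. -/

/-- A curve in a Banach space which is differentiable when tested with a separating family of
functionals, with continuous derivative, is differentiable. -/
theorem hasDerivWithinAt_of_forall_clm {E ι : Type*} [NormedAddCommGroup E] [NormedSpace ℝ E]
    [CompleteSpace E] {ℓ : ι → E →L[ℝ] ℝ} (hℓ : ∀ x y, (∀ i, ℓ i x = ℓ i y) → x = y)
    {f f' : ℝ → E} {a b : ℝ} (hf' : ContinuousOn f' (Icc a b))
    (h : ∀ i, ∀ t ∈ Icc a b,
      HasDerivWithinAt (fun s => ℓ i (f s)) (ℓ i (f' t)) (Icc a b) t)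
    {t : ℝ} (ht : t ∈ Icc a b) : HasDerivWithinAt f (f' t) (Icc a b) t := by
  rcases eq_or_lt_of_le (ht.1.trans ht.2) with hab | hab
  · subst hab
    rw [Icc_self] at ht ⊢
    rw [mem_singleton_iff.1 ht]
    exact HasFDerivWithinAt.of_subsingleton subsingleton_singleton
  -- The integral of `f'` starting from `f a` is differentiable in norm; each functional sees a
  -- constant difference between it and `f`, which is zero at `a`.
  have hg : ∀ s ∈ Icc a b,
      HasDerivWithinAt (ODE.picard (fun s _ => f' s) a (f a) f) (f' s) (Icc a b) s := fun s hs =>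
    ODE.hasDerivWithinAt_picard_Icc (f := fun s _ => f' s) (α := fun _ => (0 : E)) (u := univ)
      (left_mem_Icc.2 hab.le) (hf'.comp continuousOn_fst fun q hq => hq.1)
      continuousOn_const (fun _ _ => mem_univ _) (f a) hs
  have heq : ∀ s ∈ Icc a b, f s = ODE.picard (fun s _ => f' s) a (f a) f s := fun s hs => by
    refine hℓ _ _ fun i => ?_
    have h1 : ∀ r ∈ Icc a b, HasDerivWithinAt
        (fun r => ℓ i (f r) - ℓ i (ODE.picard (fun s _ => f' s) a (f a) f r)) 0 (Icc a b) r :=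
      fun r hr => by
        have := (h i r hr).sub ((ℓ i).hasFDerivAt.comp_hasDerivWithinAt r (hg r hr))
        rwa [sub_self] at this
    have h2 := constant_of_derivWithin_zero (fun r hr => (h1 r hr).differentiableWithinAt)
      (fun r hr => (h1 r (Ico_subset_Icc_self hr)).derivWithin
        (uniqueDiffOn_Icc hab r (Ico_subset_Icc_self hr))) s hs
    rw [ODE.picard_apply₀, sub_self] at h2
    exact sub_eq_zero.1 h2
  exact (hg t ht).congr heq (heq t ht)

/-- Uniqueness for an autonomous ODE whose vector field is `C¹` along one of the two curves. -/
theorem eqOn_Icc_of_contDiffAt {E : Type*} [NormedAddCommGroup E] [NormedSpace ℝ E]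
    {v : E → E} {f g : ℝ → E} {a b : ℝ}
    (hf : ∀ t ∈ Icc a b, HasDerivWithinAt f (v (f t)) (Icc a b) t)
    (hg : ∀ t ∈ Icc a b, HasDerivWithinAt g (v (g t)) (Icc a b) t)
    (hv : ∀ t ∈ Icc a b, ContDiffAt ℝ 1 v (f t)) (ha : f a = g a) : EqOn f g (Icc a b) := by
  have hfc : ContinuousOn f (Icc a b) := fun t ht => (hf t ht).continuousWithinAt
  have hgc : ContinuousOn g (Icc a b) := fun t ht => (hg t ht).continuousWithinAt
  have hcl : IsClosed ({t | f t = g t} ∩ Icc a b) := by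
    have := (hfc.prodMk hgc).preimage_isClosed_of_isClosed isClosed_Icc isClosed_diagonal
    rwa [inter_comm] at this
  -- Continuous induction: the coincidence set is closed, and it extends to the right of `x` because
  -- both curves stay for a while in a set where `v` is Lipschitz.
  refine hcl.Icc_subset_of_forall_mem_nhdsWithin ha fun x ⟨hx, hxab⟩ => ?_
  have hxI := Ico_subset_Icc_self hxab
  obtain ⟨K, S, hS, hK⟩ := (hv x hxI).exists_lipschitzOnWith
  have h1 : ∀ᶠ t in 𝓝[Icc a b] x, f t ∈ S ∧ g t ∈ S := by
    refine ((hfc x hxI).eventually_mem hS).and ((hgc x hxI).eventually_mem ?_)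
    rwa [← show f x = g x from hx]
  have h2 : ∀ᶠ t in 𝓝[≥] x, (f t ∈ S ∧ g t ∈ S) ∧ t ∈ Icc a b := by
    have h3 : 𝓝[≥] x ≤ 𝓝[Icc a b] x := by
      rw [← nhdsWithin_Icc_eq_nhdsGE hxab.2]
      exact nhdsWithin_mono _ (Icc_subset_Icc_left hxab.1)
    exact h3 (h1.and self_mem_nhdsWithin)
  obtain ⟨c, hc, hsub⟩ := (mem_nhdsGE_iff_exists_Icc_subset (a := x)).1 h2
  have key : ∀ {k : ℝ → E}, (∀ t ∈ Icc a b, HasDerivWithinAt k (v (k t)) (Icc a b) t) →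
      ∀ t ∈ Ico x c, HasDerivWithinAt k (v (k t)) (Ici t) t := fun hk t ht => by
    have htI := (hsub (Ico_subset_Icc_self ht)).2
    have htb : t < b := ht.2.trans_le (hsub (right_mem_Icc.2 (le_of_lt hc))).2.2
    refine (hk t htI).mono_of_mem_nhdsWithin ?_
    rw [← nhdsWithin_Icc_eq_nhdsGE htb]
    exact mem_of_superset self_mem_nhdsWithin (Icc_subset_Icc_left htI.1)
  have hE := ODE_solution_unique_of_mem_Icc_right (v := fun _ => v) (s := fun _ => S)
    (fun _ _ => hK) (hfc.mono fun t ht => (hsub ht).2) (key hf)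
    (fun t ht => (hsub (Ico_subset_Icc_self ht)).1.1)
    (hgc.mono fun t ht => (hsub ht).2) (key hg)
    (fun t ht => (hsub (Ico_subset_Icc_self ht)).1.2) hx
  exact mem_of_superset (Icc_mem_nhdsGT hc) hE

/-- Joint continuity implies uniform convergence on compact sets. -/
theorem tendstoUniformlyOn_of_continuousOn_prod {α β γ : Type*} [TopologicalSpace α]
    [TopologicalSpace β] [UniformSpace γ] {f : α × β → γ} {s : Set α} {K : Set β} {a : α}
    (hf : ContinuousOn f (s ×ˢ K)) (hs : s ∈ 𝓝 a) (hK : IsCompact K) :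
    TendstoUniformlyOn (fun w t => f (w, t)) (fun t => f (a, t)) (𝓝 a) K := by
  rw [← tendstoLocallyUniformlyOn_iff_tendstoUniformlyOn_of_compact hK]
  intro u hu t ht
  obtain ⟨w, hw, hsymm, hwu⟩ := comp_symm_mem_uniformity_sets hu
  have h1 : ∀ᶠ q in 𝓝 a ×ˢ 𝓝[K] t, (f (a, t), f q) ∈ w := by
    have h2 := hf (a, t) ⟨mem_of_mem_nhds hs, ht⟩
    rw [ContinuousWithinAt, nhdsWithin_prod_eq, nhdsWithin_eq_nhds.2 hs] at h2
    exact h2 (UniformSpace.ball_mem_nhds _ hw)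
  obtain ⟨A, hA, B, hB, hAB⟩ := mem_prod_iff.1 h1
  refine ⟨B, hB, mem_of_superset hA fun x hx y hy => hwu ?_⟩
  exact ⟨f (a, t), hsymm.symm _ _ (hAB (mk_mem_prod (mem_of_mem_nhds hA) hy)),
    hAB (mk_mem_prod hx hy)⟩

/-! ### The isometric embedding of `C⁰(𝕋)` into `L^∞(𝕋)`. -/

theorem norm_toLinf (f : C(UnitAddCircle, ℝ)) : ‖toLinf f‖ = ‖f‖ := by
  refine le_antisymm ?_ ?_
  · have h := ContinuousMap.toLp_norm_le (E := ℝ) (p := ∞) (𝕜 := ℝ)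
      (volume : Measure UnitAddCircle)
    have h2 := (ContinuousMap.toLp (E := ℝ) ∞ (volume : Measure UnitAddCircle) ℝ).le_of_opNorm_le h f
    simpa [toLinf, measureUnivNNReal] using h2
  · have hae : ∀ᵐ x : UnitAddCircle, ‖f x‖ ≤ ‖toLinf f‖ := by
      filter_upwards [ContinuousMap.coeFn_toLp (p := ∞) (𝕜 := ℝ) (volume : Measure UnitAddCircle) f,
        ae_le_eLpNormEssSup (f := toLinf f) (μ := (volume : Measure UnitAddCircle))] with x hx hx2
      have h3 : (toLinf f : UnitAddCircle → ℝ) x = f x := hx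
      rw [Lp.norm_def, eLpNorm_exponent_top, ← h3, ← toReal_enorm]
      refine ENNReal.toReal_mono ?_ hx2
      rw [← eLpNorm_exponent_top]
      exact Lp.eLpNorm_ne_top _
    refine (ContinuousMap.norm_le _ (norm_nonneg _)).2 fun x => ?_
    have hcl : IsClosed {x : UnitAddCircle | ‖f x‖ ≤ ‖toLinf f‖} :=
      isClosed_le f.continuous.norm continuous_const
    have hd := Measure.dense_of_ae hae
    exact hcl.closure_subset_iff.2 subset_rfl (hd x)

/-- `toLinf` as a linear isometry. -/
noncomputable def toLinfIso : C(UnitAddCircle, ℝ) →ₗᵢ[ℝ] Lp ℝ ∞ (volume : Measure UnitAddCircle) :=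
  ⟨(ContinuousMap.toLp (E := ℝ) ∞ (volume : Measure UnitAddCircle) ℝ).toLinearMap, norm_toLinf⟩

theorem toLinfIso_apply (f : C(UnitAddCircle, ℝ)) : toLinfIso f = toLinf f := rfl

/-- An isometry reflects limits of difference quotients, so time derivatives can be taken in the sup
norm. -/
theorem hasDerivWithinAt_toLinf_iff {g : ℝ → C(UnitAddCircle, ℝ)} {g' : C(UnitAddCircle, ℝ)}
    {s : Set ℝ} {t : ℝ} : HasDerivWithinAt (fun r => toLinf (g r)) (toLinf g') s t ↔
      HasDerivWithinAt g g' s t := by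
  refine ⟨fun h => ?_, fun h =>
    toLinfIso.toContinuousLinearMap.hasFDerivAt.comp_hasDerivWithinAt t h⟩
  rw [hasDerivWithinAt_iff_tendsto_slope] at h ⊢
  rw [toLinfIso.isometry.isEmbedding.isInducing.tendsto_nhds_iff]
  refine h.congr fun r => ?_
  simp only [slope_def_module, Function.comp_apply, map_smul, map_sub, toLinfIso_apply]

theorem HasDerivWithinAt.eval_circle {g : ℝ → C(UnitAddCircle, ℝ)} {g' : C(UnitAddCircle, ℝ)}
    {s : Set ℝ} {t : ℝ} (h : HasDerivWithinAt g g' s t) (x : UnitAddCircle) :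
    HasDerivWithinAt (fun r => g r x) (g' x) s t :=
  (ContinuousMap.evalCLM ℝ x : C(UnitAddCircle, ℝ) →L[ℝ] ℝ).hasFDerivAt.comp_hasDerivWithinAt t h

/-! ### The chain rule along moving points, and flows of `C¹` fields. -/

namespace C1Circle

theorem abs_sub_sub_le {u : C1Circle} {x y c A : ℝ} {δ : ℝ} (hy : |y - x| < δ)
    (h : ∀ z : ℝ, |z - x| < δ → |dx u (z : UnitAddCircle) - A| ≤ c) :
    |fn u (y : UnitAddCircle) - fn u (x : UnitAddCircle) - A * (y - x)| ≤ c * |y - x| := by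
  have hd : ∀ z : ℝ, HasDerivAt (fun z : ℝ => fn u (z : UnitAddCircle) - A * z)
      (dx u (z : UnitAddCircle) - A) z := fun z => by
    have := (hasDerivAt u z).sub ((hasDerivAt_id z).const_mul A)
    rw [mul_one] at this
    exact this
  have := Convex.norm_image_sub_le_of_norm_hasDerivWithin_le (s := Metric.ball x δ) (x := x) (y := y)
    (fun z _ => (hd z).hasDerivWithinAt)
    (fun z hz => h z (by simpa [Real.dist_eq] using hz)) (convex_ball x δ)
    (Metric.mem_ball_self ((abs_nonneg _).trans_lt hy)) (by simpa [Real.dist_eq] using hy)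
  rw [Real.norm_eq_abs, Real.norm_eq_abs] at this
  convert this using 2
  ring

/-- Differentiation of `s ↦ u(s, η(s)) - u(s, η(t))` at `s = t`. -/
theorem hasDerivWithinAt_sub_eval {u : ℝ → C1Circle} {η : ℝ → ℝ} {e t : ℝ} {S : Set ℝ}
    (hu : ContinuousWithinAt u S t) (hη : HasDerivWithinAt η e S t) :
    HasDerivWithinAt (fun s => fn (u s) (η s : UnitAddCircle) - fn (u s) (η t : UnitAddCircle))
      (dx (u t) (η t : UnitAddCircle) * e) S t := by
  set A := dx (u t) (η t : UnitAddCircle) with hA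
  have h1 : HasDerivWithinAt (fun s => fn (u s) (η s : UnitAddCircle) -
      fn (u s) (η t : UnitAddCircle) - A * (η s - η t)) 0 S t := by
    -- Half of `c` pays for the oscillation of `∂ₓu(t)` near `η(t)`, half for `∂ₓu(s) - ∂ₓu(t)`. No
    -- time derivative of `u` enters.
    have hO : (fun s => fn (u s) (η s : UnitAddCircle) -
        fn (u s) (η t : UnitAddCircle) - A * (η s - η t)) =o[𝓝[S] t] fun s => η s - η t := by
      refine Asymptotics.isLittleO_iff.2 fun c hc => ?_
      have h2 : ∀ᶠ z : ℝ in 𝓝 (η t), |dx (u t) (z : UnitAddCircle) - A| < c / 2 := by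
        have := (continuous_coe_circle (dx (u t))).continuousAt (x := η t)
        simpa [Real.dist_eq] using Metric.tendsto_nhds.1 this (c / 2) (by positivity)
      obtain ⟨δ, hδ, h3⟩ := Metric.eventually_nhds_iff.1 h2
      have h4 : ∀ᶠ s in 𝓝[S] t, |η s - η t| < δ := by
        simpa [Real.dist_eq] using Metric.tendsto_nhds.1 hη.continuousWithinAt δ hδ
      have h5 : ∀ᶠ s in 𝓝[S] t, ‖dx (u s) - dx (u t)‖ < c / 2 := by
        have := continuous_dx.continuousAt.comp_continuousWithinAt hu
        simpa [dist_eq_norm] using Metric.tendsto_nhds.1 this (c / 2) (by positivity)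
      filter_upwards [h4, h5] with s hs4 hs5
      refine abs_sub_sub_le hs4 fun z hz => ?_
      have h6 := h3 (show dist z (η t) < δ by rwa [Real.dist_eq])
      have h7 := ((dx (u s) - dx (u t)).norm_coe_le_norm z).trans hs5.le
      rw [ContinuousMap.sub_apply, Real.norm_eq_abs] at h7
      have h8 := _root_.abs_sub_le (dx (u s) (z : UnitAddCircle)) (dx (u t) (z : UnitAddCircle)) A
      linarith
    rw [hasDerivWithinAt_iff_isLittleO]
    simpa using hO.trans_isBigO hη.hasFDerivWithinAt.isBigO_sub
  have h2 := h1.add ((hη.sub_const (η t)).const_mul A)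
  rw [zero_add] at h2
  refine h2.congr (fun s _ => ?_) ?_ <;> simp

/-- The chain rule for `s ↦ u(s, η(s))`. -/
theorem hasDerivWithinAt_eval {u : ℝ → C1Circle} {r : C(UnitAddCircle, ℝ)} {η : ℝ → ℝ} {e t : ℝ}
    {S : Set ℝ} (hu : ContinuousWithinAt u S t)
    (hr : HasDerivWithinAt (fun s => fn (u s)) r S t) (hη : HasDerivWithinAt η e S t) :
    HasDerivWithinAt (fun s => fn (u s) (η s : UnitAddCircle))
      (r (η t : UnitAddCircle) + dx (u t) (η t : UnitAddCircle) * e) S t := by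
  have h1 : HasDerivWithinAt (fun s => fn (u s) (η t : UnitAddCircle))
      (r (η t : UnitAddCircle)) S t :=
    hr.eval_circle _
  have h2 := h1.add (hasDerivWithinAt_sub_eval hu hη)
  refine h2.congr (fun s _ => ?_) ?_ <;> simp

end C1Circle

theorem HasDerivWithinAt.Ici_of_Icc {E : Type*} [NormedAddCommGroup E] [NormedSpace ℝ E]
    {f : ℝ → E} {f' : E} {a b t : ℝ} (h : HasDerivWithinAt f f' (Icc a b) t) (ht : t ∈ Ico a b) :
    HasDerivWithinAt f f' (Ici t) t := by
  refine h.mono_of_mem_nhdsWithin ?_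
  rw [← nhdsWithin_Icc_eq_nhdsGE ht.2]
  exact mem_of_superset self_mem_nhdsWithin (Icc_subset_Icc_left ht.1)

theorem gronwallBound_zero_eq_mul (K ε x : ℝ) :
    gronwallBound 0 K ε x = ε * gronwallBound 0 K 1 x := by
  by_cases hK : K = 0
  · simp [hK, gronwallBound_K0]
  · simp only [gronwallBound_of_K_ne_0 hK]
    ring

theorem gronwallBound_zero_one_nonneg {K x : ℝ} (hK : 0 ≤ K) (hx : 0 ≤ x) :
    0 ≤ gronwallBound 0 K 1 x := by
  have h := gronwallBound_mono le_rfl zero_le_one hK hx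
  rwa [gronwallBound_x0] at h

namespace C1Circle

/-- Differentiability of a flow with respect to the initial point. -/
theorem hasDerivAt_flow {g : ℝ → C1Circle} {φ B : ℝ → C(UnitAddCircle, ℝ)} {T : ℝ}
    (hg : ContinuousOn g (Icc 0 T))
    (hφ : ∀ t ∈ Icc 0 T, HasDerivWithinAt φ (shiftComp (fn (g t)) (φ t)) (Icc 0 T) t)
    (hφ0 : φ 0 = 0)
    (hB : ∀ t ∈ Icc 0 T, HasDerivWithinAt B (shiftComp (dx (g t)) (φ t)) (Icc 0 T) t)
    (hB0 : B 0 = 0) {t : ℝ} (ht : t ∈ Icc 0 T) (y : ℝ) :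
    HasDerivAt (fun z : ℝ => z + φ t (z : UnitAddCircle)) (Real.exp (B t (y : UnitAddCircle))) y := by
  obtain ⟨C, hC⟩ := isCompact_Icc.exists_bound_of_continuousOn hg
  set K : ℝ≥0 := C.toNNReal with hKdef
  have hK : ∀ s ∈ Icc 0 T, ‖dx (g s)‖ ≤ K := fun s hs =>
    ((norm_dx_le _).trans (hC s hs)).trans (Real.le_coe_toNNReal C)
  set η : ℝ → ℝ → ℝ := fun s z => z + φ s (z : UnitAddCircle) with hηdef
  have hη : ∀ z, ∀ s ∈ Icc 0 T, HasDerivWithinAt (fun s => η s z)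
      (fn (g s) (η s z : UnitAddCircle)) (Icc 0 T) s := fun z s hs => by
    have := ((hφ s hs).eval_circle (z : UnitAddCircle)).const_add z
    rwa [shiftComp_coe] at this
  have hηc : ∀ z, ContinuousOn (fun s => η s z) (Icc 0 T) :=
    fun z s hs => (hη z s hs).continuousWithinAt
  set E := Real.exp (K * T) with hE
  have h1 : ∀ z, ∀ s ∈ Icc 0 T, |η s z - η s y| ≤ |z - y| * E := fun z s hs => by
    have := dist_le_of_trajectories_ODE_of_mem (v := fun s (z : ℝ) => fn (g s) (z : UnitAddCircle))
      (s := fun _ => univ) (K := K) (δ := |z - y|)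
      (fun s hs => LipschitzOnWith.of_dist_le_mul fun a _ b _ =>
        (abs_sub_le (g s) a b).trans (mul_le_mul_of_nonneg_right (hK s (Ico_subset_Icc_self hs))
          (abs_nonneg _)))
      (hηc z) (fun s hs => (hη z s (Ico_subset_Icc_self hs)).Ici_of_Icc hs) (fun _ _ => mem_univ _)
      (hηc y) (fun s hs => (hη y s (Ico_subset_Icc_self hs)).Ici_of_Icc hs) (fun _ _ => mem_univ _)
      (by simp [hηdef, hφ0, Real.dist_eq]) s hs
    rw [sub_zero, Real.dist_eq] at this
    refine this.trans (mul_le_mul_of_nonneg_left (Real.exp_le_exp.2 ?_) (abs_nonneg _))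
    exact mul_le_mul_of_nonneg_left hs.2 K.2
  have h2 : TendstoUniformlyOn (fun (d : ℝ) s => dx (g s) ((η s y + d : ℝ) : UnitAddCircle))
      (fun s => dx (g s) ((η s y + 0 : ℝ) : UnitAddCircle)) (𝓝 0) (Icc 0 T) := by
    refine tendstoUniformlyOn_of_continuousOn_prod (s := univ)
      (f := fun q : ℝ × ℝ => dx (g q.2) ((η q.2 y + q.1 : ℝ) : UnitAddCircle)) ?_ univ_mem
      isCompact_Icc
    have hg2 : ContinuousOn (fun q : ℝ × ℝ => dx (g q.2)) (univ ×ˢ Icc 0 T) :=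
      continuous_dx.comp_continuousOn (hg.comp continuousOn_snd fun q hq => hq.2)
    have hη2 : ContinuousOn (fun q : ℝ × ℝ => ((η q.2 y + q.1 : ℝ) : UnitAddCircle))
        (univ ×ˢ Icc 0 T) :=
      (AddCircle.continuous_mk' 1).comp_continuousOn
        (((hηc y).comp continuousOn_snd fun q hq => hq.2).add continuousOn_fst)
    exact continuous_eval.comp_continuousOn (hg2.prodMk hη2)
  set M := gronwallBound 0 K 1 t with hM
  have hM0 : 0 ≤ M := gronwallBound_zero_one_nonneg K.2 ht.1
  have hE0 : 0 < E := Real.exp_pos _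
  rw [hasDerivAt_iff_isLittleO]
  refine Asymptotics.isLittleO_iff.2 fun c hc => ?_
  -- The final error is `ε E M |z - y|`; `M + 1` replaces `M`, which vanishes at `t = 0`.
  set ε := c / (E * (M + 1)) with hε
  have hε0 : 0 < ε := by positivity
  obtain ⟨δ, hδ, h3⟩ := Metric.eventually_nhds_iff.1 (Metric.tendstoUniformlyOn_iff.1 h2 ε hε0)
  have h4 : ∀ᶠ z in 𝓝 y, |z - y| * E < δ := by
    have : Tendsto (fun z => |z - y| * E) (𝓝 y) (𝓝 (|y - y| * E)) :=
      ((continuous_id.sub continuous_const).abs.mul continuous_const).tendsto y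
    rw [sub_self, abs_zero, zero_mul] at this
    exact this.eventually_lt_const hδ
  filter_upwards [h4] with z hz
  have h5 : ∀ s ∈ Icc 0 T, |fn (g s) (η s z : UnitAddCircle) - fn (g s) (η s y : UnitAddCircle) -
      dx (g s) (η s y : UnitAddCircle) * (η s z - η s y)| ≤ ε * (|z - y| * E) := fun s hs => by
    refine (abs_sub_sub_le (c := ε) (δ := δ) ((h1 z s hs).trans_lt hz) fun w hw => ?_).trans
      (mul_le_mul_of_nonneg_left (h1 z s hs) hε0.le)
    have h6 := h3 (y := w - η s y) (by simpa [Real.dist_eq] using hw) s hs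
    rw [add_zero, add_sub_cancel, dist_comm, Real.dist_eq] at h6
    exact h6.le
  have hexp : ∀ s ∈ Icc 0 T, HasDerivWithinAt
      (fun s => (z - y) * Real.exp (B s (y : UnitAddCircle)))
      (dx (g s) (η s y : UnitAddCircle) * ((z - y) * Real.exp (B s (y : UnitAddCircle))))
      (Icc 0 T) s := fun s hs => by
    have := (((hB s hs).eval_circle (y : UnitAddCircle)).exp).const_mul (z - y)
    rw [shiftComp_coe] at this
    refine this.congr_deriv ?_
    ring
  -- Gronwall compares `η(z) - η(y)`, which solves the linearised equation up to `ε E |z - y|`, with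
  -- its exact solution `(z - y) exp B`.
  have h7 := dist_le_of_approx_trajectories_ODE_of_mem
    (v := fun s d => dx (g s) (η s y : UnitAddCircle) * d) (s := fun _ => univ) (K := K)
    (f := fun s => η s z - η s y) (g := fun s => (z - y) * Real.exp (B s (y : UnitAddCircle)))
    (εf := ε * (|z - y| * E)) (εg := 0) (δ := 0)
    (fun s hs => LipschitzOnWith.of_dist_le_mul fun a _ b _ => by
      rw [Real.dist_eq, Real.dist_eq, ← mul_sub, abs_mul]
      exact mul_le_mul_of_nonneg_right (((dx (g s)).norm_coe_le_norm _).trans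
        (hK s (Ico_subset_Icc_self hs))) (abs_nonneg _))
    ((hηc z).sub (hηc y))
    (fun s hs => ((hη z s (Ico_subset_Icc_self hs)).sub
      (hη y s (Ico_subset_Icc_self hs))).Ici_of_Icc hs)
    (fun s hs => h5 s (Ico_subset_Icc_self hs)) (fun _ _ => mem_univ _)
    (fun s hs => (hexp s hs).continuousWithinAt)
    (fun s hs => (hexp s (Ico_subset_Icc_self hs)).Ici_of_Icc hs)
    (fun s _ => (dist_self _).le) (fun _ _ => mem_univ _)
    (by simp [hηdef, hφ0, hB0]) t ht
  rw [add_zero, sub_zero, gronwallBound_zero_eq_mul, ← hM, Real.dist_eq] at h7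
  rw [smul_eq_mul, Real.norm_eq_abs, Real.norm_eq_abs]
  refine h7.trans ?_
  have h8 : ε * (E * (M + 1)) = c := div_mul_cancel₀ _ (by positivity)
  have h9 : 0 ≤ ε * E * |z - y| := by positivity
  calc ε * (|z - y| * E) * M = ε * E * |z - y| * M := by ring
    _ ≤ ε * E * |z - y| * (M + 1) := mul_le_mul_of_nonneg_left (by linarith) h9
    _ = ε * (E * (M + 1)) * |z - y| := by ring
    _ = c * |z - y| := by rw [h8]

/-- Point evaluations separate `C¹(𝕋)`, so `∂ₓf` never has to be differentiated in time. -/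
theorem hasDerivWithinAt_of_eval {f f' : ℝ → C1Circle} {a b : ℝ} (hf' : ContinuousOn f' (Icc a b))
    (h : ∀ x : ℝ, ∀ t ∈ Icc a b, HasDerivWithinAt (fun s => fn (f s) (x : UnitAddCircle))
      (fn (f' t) (x : UnitAddCircle)) (Icc a b) t) {t : ℝ} (ht : t ∈ Icc a b) :
    HasDerivWithinAt f (f' t) (Icc a b) t := by
  refine hasDerivWithinAt_of_forall_clm
    (ℓ := fun x : ℝ => (ContinuousMap.evalCLM ℝ (x : UnitAddCircle) :
      C(UnitAddCircle, ℝ) →L[ℝ] ℝ).comp fnL) (fun u v huv => ext_fn ?_) hf' h ht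
  ext x
  induction x using QuotientAddGroup.induction_on with
  | H x => exact huv x

/-- The flow of a time dependent `C¹` vector field on the circle. -/
theorem exists_flow {g : ℝ → C1Circle} {T : ℝ} (hT : 0 ≤ T) (hg : ContinuousOn g (Icc 0 T)) :
    ∃ Φ : ℝ → C1Circle, Φ 0 = 0 ∧ ∀ t ∈ Icc 0 T,
      HasDerivWithinAt Φ (comp (g t) (Φ t)) (Icc 0 T) t ∧ IsUnit (1 + dx (Φ t)) := by
  obtain ⟨C, hC⟩ := isCompact_Icc.exists_bound_of_continuousOn hg
  have hC' : ∀ s ∈ Icc 0 T, ‖g s‖ ≤ C.toNNReal := fun s hs =>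
    (hC s hs).trans (Real.le_coe_toNNReal C)
  have h0T : (0 : ℝ) ∈ Icc 0 T := left_mem_Icc.2 hT
  have hfg : ContinuousOn (fun s => fn (g s)) (Icc 0 T) := continuous_fn.comp_continuousOn hg
  -- The flow is first found in `C⁰`, where the field is globally bounded and Lipschitz, so it lives
  -- on all of `[0, T]`.
  have hPL : IsPicardLindelof (fun t φ => shiftComp (fn (g t)) φ) (tmin := 0) (tmax := T)
      ⟨0, h0T⟩ 0 (C.toNNReal * T.toNNReal) 0 C.toNNReal C.toNNReal :=
    { lipschitzOnWith := fun t ht => LipschitzOnWith.of_dist_le_mul fun a _ b _ => by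
        rw [dist_eq_norm, dist_eq_norm]
        exact (norm_shiftComp_sub_le (g t) a b).trans
          (mul_le_mul_of_nonneg_right ((norm_dx_le _).trans (hC' t ht)) (norm_nonneg _))
      continuousOn := fun φ _ => continuous_shiftComp.comp_continuousOn
        (hfg.prodMk continuousOn_const)
      norm_le := fun t ht φ _ => (norm_shiftComp_le _ _).trans ((norm_fn_le _).trans (hC' t ht))
      mul_max_le := by simp [hT] }
  obtain ⟨φ, hφ0, hφ⟩ := hPL.exists_eq_forall_mem_Icc_hasDerivWithinAt₀
  have hφ0' : φ 0 = 0 := hφ0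
  have hφc : ContinuousOn φ (Icc 0 T) := fun t ht => (hφ t ht).continuousWithinAt
  set A : ℝ → C(UnitAddCircle, ℝ) := fun s => shiftComp (dx (g s)) (φ s) with hA
  have hAc : ContinuousOn A (Icc 0 T) :=
    continuous_shiftComp.comp_continuousOn ((continuous_dx.comp_continuousOn hg).prodMk hφc)
  -- `B` is the time integral of `∂ₓg` along the flow. The Jacobian is `exp B`, continuous in time
  -- and never zero.
  set B : ℝ → C(UnitAddCircle, ℝ) := ODE.picard (fun s _ => A s) 0 0 0 with hBdef
  have hB : ∀ s ∈ Icc 0 T, HasDerivWithinAt B (A s) (Icc 0 T) s := fun s hs =>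
    ODE.hasDerivWithinAt_picard_Icc (f := fun s _ => A s) (α := 0)
      (u := univ) h0T (hAc.comp continuousOn_fst fun q hq => hq.1)
      continuousOn_const (fun _ _ => mem_univ _) 0 hs
  have hB0 : B 0 = 0 := ODE.picard_apply₀
  have hBc : ContinuousOn B (Icc 0 T) := fun t ht => (hB t ht).continuousWithinAt
  set ex : C(ℝ, ℝ) := ⟨Real.exp, Real.continuous_exp⟩ with hex
  have hΦ : ∀ t, ∃ Ψ : C1Circle, t ∈ Icc 0 T → fn Ψ = φ t ∧ dx Ψ = ex.comp (B t) - 1 := fun t => by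
    by_cases ht : t ∈ Icc 0 T
    · refine ⟨mk (φ t) (ex.comp (B t) - 1) fun y => ?_, fun _ => ⟨rfl, rfl⟩⟩
      have := (hasDerivAt_flow hg hφ hφ0' hB hB0 ht y).sub (hasDerivAt_id y)
      refine this.congr_of_eventuallyEq (Eventually.of_forall fun z => ?_)
      simp
    · exact ⟨0, fun h => absurd h ht⟩
  choose Φ hΦ using hΦ
  have hΦc : ContinuousOn Φ (Icc 0 T) := by
    refine continuousOn_iff.2 ⟨hφc.congr fun t ht => (hΦ t ht).1, ?_⟩
    refine ContinuousOn.congr (f := fun t => ex.comp (B t) - 1) ?_ fun t ht => (hΦ t ht).2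
    exact (ex.continuous_postcomp.comp_continuousOn hBc).sub continuousOn_const
  refine ⟨Φ, ext_fn (by rw [(hΦ 0 h0T).1, hφ0', fn_zero]), fun t ht => ⟨?_, ?_⟩⟩
  · refine hasDerivWithinAt_of_eval (f' := fun t => comp (g t) (Φ t))
      (continuous_comp.comp_continuousOn (hg.prodMk hΦc)) (fun x t ht => ?_) ht
    rw [fn_comp, (hΦ t ht).1]
    exact ((hφ t ht).eval_circle x).congr (fun s hs => by rw [(hΦ s hs).1]) (by rw [(hΦ t ht).1])
  · rw [(hΦ t ht).2, ContinuousMap.isUnit_iff_forall_ne_zero]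
    intro x
    simp [hex, Real.exp_ne_zero]

end C1Circle

/-! ### From solutions to Lagrangian integral curves; uniqueness. -/

namespace IsMHSSolution

open C1Circle

variable {p : ℕ} {x₀ T : ℝ} {u₀ : C1Circle} {u v : ℝ → C1Circle}

theorem _root_.C1Circle.isBoundedLinearMap_fn : IsBoundedLinearMap ℝ fn :=
  IsLinearMap.with_bound ⟨fun _ _ => rfl, fun _ _ => rfl⟩ 1 fun u => by
    rw [one_mul]
    exact norm_fn_le u

theorem _root_.IsBoundedLinearMap.hasDerivWithinAt_comp {E F : Type*} [NormedAddCommGroup E]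
    [NormedSpace ℝ E] [NormedAddCommGroup F] [NormedSpace ℝ F] {L : E → F}
    (hL : IsBoundedLinearMap ℝ L) {f : ℝ → E} {f' : E} {s : Set ℝ} {t : ℝ}
    (h : HasDerivWithinAt f f' s t) : HasDerivWithinAt (fun r => L (f r)) (L f') s t :=
  hL.hasFDerivAt.comp_hasDerivWithinAt t h

theorem timeDeriv_eq (h : IsMHSSolution p x₀ T u₀ u) {t : ℝ} (ht : t ∈ Ico 0 T) :
    timeDeriv T u t = toLinf (mhsRhs p x₀ (u t)) := by
  have h1 := h.equation t ht
  rw [← toLinfIso_apply, ← toLinfIso_apply] at h1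
  rw [← toLinfIso_apply, mhsRhs, map_sub, force, ← h1, add_sub_cancel_right]

theorem hasDerivWithinAt (h : IsMHSSolution p x₀ T u₀ u) {t : ℝ} (ht : t ∈ Ico 0 T) :
    HasDerivWithinAt (fun s => fn (u s)) (mhsRhs p x₀ (u t)) (Ico 0 T) t := by
  rw [← hasDerivWithinAt_toLinf_iff, ← h.timeDeriv_eq ht]
  exact (h.contDiffOn.differentiableOn one_ne_zero t ht).hasDerivWithinAt

/-- Continuity of the time derivative is automatic, since `mhsRhs` is continuous on `C¹(𝕋)`. -/
theorem of_hasDerivWithinAt (h0 : u 0 = u₀) (hc : ContinuousOn u (Ico 0 T))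
    (h : ∀ t ∈ Ico 0 T, HasDerivWithinAt (fun s => fn (u s)) (mhsRhs p x₀ (u t)) (Ico 0 T) t) :
    IsMHSSolution p x₀ T u₀ u := by
  have hd : ∀ t ∈ Ico 0 T, timeDeriv T u t = toLinf (mhsRhs p x₀ (u t)) := fun t ht =>
    (hasDerivWithinAt_toLinf_iff.2 (h t ht)).derivWithin (uniqueDiffOn_Ico 0 T t ht)
  refine ⟨h0, hc, ?_, fun t ht => ?_⟩
  · rw [contDiffOn_one_iff_derivWithin (uniqueDiffOn_Ico 0 T)]
    refine ⟨fun t ht => (hasDerivWithinAt_toLinf_iff.2 (h t ht)).differentiableWithinAt, ?_⟩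
    refine ContinuousOn.congr (f := fun t => toLinf (mhsRhs p x₀ (u t))) ?_ hd
    exact toLinfIso.continuous.comp_continuousOn ((continuous_mhsRhs p x₀).comp_continuousOn hc)
  · rw [hd t ht, ← toLinfIso_apply, ← toLinfIso_apply, ← toLinfIso_apply, ← map_add, mhsRhs,
      sub_add_cancel]
    rfl

theorem _root_.HasDerivWithinAt.fn_c1Circle {f : ℝ → C1Circle} {f' : C1Circle} {s : Set ℝ} {t : ℝ}
    (h : HasDerivWithinAt f f' s t) : HasDerivWithinAt (fun r => fn (f r)) (fn f') s t :=
  isBoundedLinearMap_fn.hasDerivWithinAt_comp (E := C1Circle) h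

/-- A solution in Lagrangian coordinates is an integral curve of `lagrangianField`. -/
theorem hasDerivWithinAt_lagrangian {b : ℝ}
    (h : IsMHSSolution p x₀ T u₀ u) (hb : b < T) {Φ : ℝ → C1Circle}
    (hΦ : ∀ t ∈ Icc 0 b, HasDerivWithinAt Φ (comp (pow (u t) p) (Φ t)) (Icc 0 b) t ∧
      IsUnit (1 + dx (Φ t))) {t : ℝ} (ht : t ∈ Icc 0 b) :
    HasDerivWithinAt (fun t => (Φ t, comp (u t) (Φ t)))
      (lagrangianField p x₀ (Φ t, comp (u t) (Φ t))) (Icc 0 b) t := by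
  have hsub : Icc 0 b ⊆ Ico 0 T := fun t ht => ⟨ht.1, ht.2.trans_lt hb⟩
  have huc : ContinuousOn u (Icc 0 b) := h.continuousOn.mono hsub
  have hΦc : ContinuousOn Φ (Icc 0 b) := fun t ht =>
    HasDerivWithinAt.continuousWithinAt (F := C1Circle) (hΦ t ht).1
  rw [lagrangianField_comp p x₀ (hΦ t ht).2]
  refine HasDerivWithinAt.prodMk (𝕜 := ℝ) (F := C1Circle) (G := C1Circle) (hΦ t ht).1 ?_
  have hF : Continuous fun u => dxInvC1 x₀ (force p u) :=
    (continuous_dxInvC1 x₀).comp (continuous_force p)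
  have hc : ContinuousOn (fun t => comp (dxInvC1 x₀ (force p (u t))) (Φ t)) (Icc 0 b) :=
    continuous_comp.comp_continuousOn ((hF.comp_continuousOn huc).prodMk hΦc)
  have hc' : ContinuousOn (fun t => (1 / 2 : ℝ) • comp (dxInvC1 x₀ (force p (u t))) (Φ t))
      (Icc 0 b) := (continuous_const_smul (1 / 2 : ℝ)).comp_continuousOn hc
  refine hasDerivWithinAt_of_eval
    (f' := fun t => (1 / 2 : ℝ) • comp (dxInvC1 x₀ (force p (u t))) (Φ t))
    hc' (fun x t ht => ?_) ht
  have h1 : HasDerivWithinAt (fun s => fn (Φ s)) (shiftComp (fn (u t) ^ p) (fn (Φ t)))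
      (Icc 0 b) t := by
    have := (hΦ t ht).1.fn_c1Circle
    rwa [fn_comp, fn_pow] at this
  have h2 := (h1.eval_circle (x : UnitAddCircle)).const_add x
  -- Moving with speed `uᵖ` contributes `uᵖ ∂ₓu`, which cancels the transport term of `mhsRhs`.
  have h3 := hasDerivWithinAt_eval (huc t ht) ((h.hasDerivWithinAt (hsub ht)).mono hsub) h2
  simp only [fn_comp, shiftComp_coe]
  refine h3.congr_deriv ?_
  simp only [mhsRhs, fn_smul, fn_comp, fn_dxInvC1, ContinuousMap.sub_apply,
    ContinuousMap.smul_apply, ContinuousMap.mul_apply, shiftComp_coe, ContinuousMap.pow_apply]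
  ring

/-- Each solution is lifted by its own flow. ODE uniqueness identifies the flows as well, so a
single shift is left to cancel. -/
theorem eqOn (hu : IsMHSSolution p x₀ T u₀ u) (hv : IsMHSSolution p x₀ T u₀ v) :
    EqOn u v (Ico 0 T) := by
  intro b hb
  have hsub : Icc 0 b ⊆ Ico 0 T := fun t ht => ⟨ht.1, ht.2.trans_lt hb.2⟩
  obtain ⟨Φ, hΦ0, hΦ⟩ := exists_flow hb.1
    ((continuous_pow p).comp_continuousOn (hu.continuousOn.mono hsub))
  obtain ⟨Ψ, hΨ0, hΨ⟩ := exists_flow hb.1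
    ((continuous_pow p).comp_continuousOn (hv.continuousOn.mono hsub))
  have key := eqOn_Icc_of_contDiffAt
    (fun t ht => hu.hasDerivWithinAt_lagrangian hb.2 hΦ ht)
    (fun t ht => hv.hasDerivWithinAt_lagrangian hb.2 hΨ ht)
    (fun t ht => contDiffAt_lagrangianField p x₀ (hΦ t ht).2)
    (by simp only [hΦ0, hΨ0, hu.initial, hv.initial]) (right_mem_Icc.2 hb.1)
  obtain ⟨h1, h2⟩ := Prod.ext_iff.1 key
  simp only at h1 h2
  rw [← h1] at h2
  exact ext_fn (shiftComp_injective (fn (Φ b)) (congrArg fn h2))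

end IsMHSSolution

/-! ### From Lagrangian integral curves to solutions; existence. -/

namespace C1Circle

theorem isBoundedLinearMap_fn_fst :
    IsBoundedLinearMap ℝ (fun q : C1Circle × C1Circle => fn q.1) :=
  IsLinearMap.with_bound ⟨fun _ _ => rfl, fun _ _ => rfl⟩ 1 fun q => by
    rw [one_mul]
    exact (norm_fn_le q.1).trans (norm_fst_le q)

theorem isBoundedLinearMap_fn_snd :
    IsBoundedLinearMap ℝ (fun q : C1Circle × C1Circle => fn q.2) :=
  IsLinearMap.with_bound ⟨fun _ _ => rfl, fun _ _ => rfl⟩ 1 fun q => by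
    rw [one_mul]
    exact (norm_fn_le q.2).trans (norm_snd_le q)

theorem eulerian_zero (u : C1Circle) : eulerian 0 u = u := by
  have h := comp_eulerian (φ := 0) (by simp) u
  refine Eq.trans (ext_fn ?_) h
  ext x
  simp [shiftComp_apply]

/-- An integral curve of `lagrangianField` gives a solution in Eulerian coordinates. -/
theorem hasDerivWithinAt_eulerian {p : ℕ} {x₀ b : ℝ} {γ : ℝ → C1Circle × C1Circle}
    (hγ : ∀ t ∈ Icc 0 b, HasDerivWithinAt γ (lagrangianField p x₀ (γ t)) (Icc 0 b) t)
    (h : ∀ t ∈ Icc 0 b, ‖dx (γ t).1‖ ≤ 1 / 2) {t : ℝ} (ht : t ∈ Icc 0 b) :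
    HasDerivWithinAt (fun s => fn (eulerian (γ s).1 (γ s).2))
      (mhsRhs p x₀ (eulerian (γ t).1 (γ t).2)) (Icc 0 b) t := by
  have hγc : ContinuousOn γ (Icc 0 b) := fun t ht =>
    HasDerivWithinAt.continuousWithinAt (F := C1Circle × C1Circle) (hγ t ht)
  set u : ℝ → C1Circle := fun s => eulerian (γ s).1 (γ s).2 with hu
  have huc : ContinuousOn u (Icc 0 b) := continuousOn_eulerian.comp hγc fun s hs => h s hs
  refine hasDerivWithinAt_of_forall_clm (ℓ := fun x : ℝ => (ContinuousMap.evalCLM ℝ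
    (x : UnitAddCircle) : C(UnitAddCircle, ℝ) →L[ℝ] ℝ)) (f' := fun t => mhsRhs p x₀ (u t))
    (fun f g hfg => ?_) ((continuous_mhsRhs p x₀).comp_continuousOn huc) (fun x t ht => ?_) ht
  · ext x
    induction x using QuotientAddGroup.induction_on with
    | H x => exact hfg x
  · have hcomp : ∀ s ∈ Icc 0 b, comp (u s) (γ s).1 = (γ s).2 := fun s hs =>
      comp_eulerian (h s hs) _
    -- The label of the particle that is at `x` at time `t`, kept fixed while `s` varies.
    set y := x + shiftInv (γ t).1 (x : UnitAddCircle) with hy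
    set η : ℝ → ℝ := fun s => y + fn (γ s).1 (y : UnitAddCircle) with hη
    have hηt : η t = x := shiftInv_coe (h t ht) x
    have hq : γ t = ((γ t).1, comp (u t) (γ t).1) := by rw [hcomp t ht]
    have hfield : lagrangianField p x₀ (γ t) = (comp (pow (u t) p) (γ t).1,
        (1 / 2 : ℝ) • comp (dxInvC1 x₀ (force p (u t))) (γ t).1) := by
      rw [hq]
      exact lagrangianField_comp p x₀ (isUnit_one_add_dx (h t ht)) (u t)
    have h1 : HasDerivWithinAt η (fn (u t) (x : UnitAddCircle) ^ p) (Icc 0 b) t := by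
      have := ((isBoundedLinearMap_fn_fst.hasDerivWithinAt_comp
        (E := C1Circle × C1Circle) (hγ t ht)).eval_circle
        (y : UnitAddCircle)).const_add y
      simp only [hfield, fn_comp, fn_pow, shiftComp_coe, ContinuousMap.pow_apply] at this
      rw [← hηt]
      exact this
    have h2 : HasDerivWithinAt (fun s => fn (γ s).2 (y : UnitAddCircle))
        (1 / 2 * dxInv x₀ (force p (u t)) (x : UnitAddCircle)) (Icc 0 b) t := by
      have := (isBoundedLinearMap_fn_snd.hasDerivWithinAt_comp
        (E := C1Circle × C1Circle) (hγ t ht)).eval_circle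
        (y : UnitAddCircle)
      rw [← hηt]
      simp only [hfield, fn_smul, fn_comp, ContinuousMap.smul_apply, shiftComp_coe,
        fn_dxInvC1, smul_eq_mul] at this
      exact this
    have h3 := h2.sub (hasDerivWithinAt_sub_eval (huc t ht) h1)
    rw [hηt] at h3
    -- The first term is differentiated by the ODE; the bracket needs only continuity of `u` in
    -- `C¹(𝕋)`. So differentiability of `u` in time is not presupposed.
    have heq : ∀ s ∈ Icc 0 b, fn (u s) (x : UnitAddCircle) = fn (γ s).2 (y : UnitAddCircle) -
        (fn (u s) (η s : UnitAddCircle) - fn (u s) (x : UnitAddCircle)) := fun s hs => by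
      rw [← hcomp s hs, fn_comp, shiftComp_coe]
      ring
    refine (h3.congr heq (heq t ht)).congr_deriv ?_
    simp only [mhsRhs, ContinuousMap.evalCLM_apply, ContinuousMap.sub_apply,
      ContinuousMap.smul_apply, ContinuousMap.mul_apply, ContinuousMap.pow_apply, smul_eq_mul]
    ring

/-- The local flow of `lagrangianField`, with uniformly small displacement. -/
theorem exists_lagrangian_flow (p : ℕ) (x₀ : ℝ) (u₀ : C1Circle) :
    ∃ T > 0, ∃ r > 0, ∃ γ : C1Circle × ℝ → C1Circle × C1Circle,
      ContinuousOn γ (Metric.ball u₀ r ×ˢ Icc 0 T) ∧ ∀ v ∈ Metric.ball u₀ r, γ (v, 0) = (0, v) ∧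
        ∀ t ∈ Icc 0 T, HasDerivWithinAt (fun s => γ (v, s)) (lagrangianField p x₀ (γ (v, t)))
          (Icc 0 T) t ∧ ‖dx (γ (v, t)).1‖ ≤ 1 / 2 := by
  have hV : ContDiffAt ℝ 1 (lagrangianField p x₀) (0, u₀) :=
    contDiffAt_lagrangianField p x₀ (by simp)
  obtain ⟨ε, hε, a, r, L, K, hr, hPL⟩ := IsPicardLindelof.of_contDiffAt_one hV
  obtain ⟨α, hα, hαc⟩ := (hPL 0).exists_forall_mem_closedBall_eq_hasDerivWithinAt_continuousOn
  have hr' : (0 : ℝ) < r := hr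
  have hmem : ∀ v ∈ Metric.ball u₀ (r : ℝ),
      ((0, v) : C1Circle × C1Circle) ∈ Metric.closedBall (0, u₀) (r : ℝ) := fun v hv => by
    rw [Metric.mem_closedBall, Prod.dist_eq, dist_self, max_eq_right dist_nonneg]
    exact (Metric.mem_ball.1 hv).le
  set γ : C1Circle × ℝ → C1Circle × C1Circle := fun q => α ((0, q.1), q.2) with hγdef
  have hIcc : Icc 0 ε ⊆ Icc (0 - ε) (0 + ε) := by
    rw [zero_sub, zero_add]
    exact Icc_subset_Icc_left (by linarith)
  have hγc : ContinuousOn γ (Metric.ball u₀ (r : ℝ) ×ˢ Icc 0 ε) :=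
    hαc.comp (((continuous_const.prodMk continuous_fst).prodMk continuous_snd).continuousOn)
      fun q hq => ⟨hmem q.1 hq.1, hIcc hq.2⟩
  have hγ0 : ∀ v ∈ Metric.ball u₀ (r : ℝ), γ (v, 0) = (0, v) := fun v hv => (hα _ (hmem v hv)).1
  have h0 : (u₀, (0 : ℝ)) ∈ Metric.ball u₀ (r : ℝ) ×ˢ Icc 0 ε :=
    ⟨Metric.mem_ball_self hr', left_mem_Icc.2 hε.le⟩
  -- The displacement vanishes at time `0`, so joint continuity at `(u₀, 0)` gives one time and one
  -- radius that work for all nearby data.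
  have hsmall : ∀ᶠ q in 𝓝[Metric.ball u₀ (r : ℝ) ×ˢ Icc 0 ε] (u₀, (0 : ℝ)),
      ‖dx (γ q).1‖ < 1 / 2 := by
    have hc : ContinuousWithinAt (fun q => ‖dx (γ q).1‖) (Metric.ball u₀ (r : ℝ) ×ˢ Icc 0 ε)
        (u₀, (0 : ℝ)) :=
      ((continuous_dx.comp continuous_fst).norm.comp_continuousOn hγc) _ h0
    refine Tendsto.eventually_lt_const ?_ hc
    simp only [hγ0 u₀ h0.1, dx_zero, norm_zero]
    norm_num
  obtain ⟨δ, hδ, hsub⟩ := Metric.mem_nhdsWithin_iff.1 hsmall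
  have hT : 0 < min ε (δ / 2) := lt_min hε (by positivity)
  have hTε : Icc 0 (min ε (δ / 2)) ⊆ Icc 0 ε := Icc_subset_Icc_right (min_le_left _ _)
  have hball : Metric.ball u₀ (min (r : ℝ) δ) ⊆ Metric.ball u₀ (r : ℝ) :=
    Metric.ball_subset_ball (min_le_left _ _)
  refine ⟨min ε (δ / 2), hT, min (r : ℝ) δ, lt_min hr' hδ, γ,
    hγc.mono (prod_mono hball hTε), fun v hv => ⟨hγ0 v (hball hv), fun t ht => ⟨?_, ?_⟩⟩⟩
  · exact ((hα _ (hmem v (hball hv))).2 t (hIcc (hTε ht))).mono (hTε.trans hIcc)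
  · refine (hsub ⟨?_, hball hv, hTε ht⟩ : ‖dx (γ (v, t)).1‖ < 1 / 2).le
    rw [Metric.mem_ball, Prod.dist_eq, max_lt_iff]
    refine ⟨(Metric.mem_ball.1 hv).trans_le (min_le_right _ _), ?_⟩
    rw [Real.dist_eq, sub_zero, abs_of_nonneg ht.1]
    linarith [ht.2, min_le_right ε (δ / 2)]

end C1Circle

theorem mainTheorem2 (p : ℕ) (hp : 1 ≤ p) (x₀ : ℝ) :
    -- uniqueness on every interval `[0, T)`
    (∀ (T : ℝ) (u₀ : C1Circle) (u v : ℝ → C1Circle),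
      IsMHSSolution p x₀ T u₀ u → IsMHSSolution p x₀ T u₀ v → EqOn u v (Ico 0 T)) ∧
    -- existence, with a time of existence that is common to all nearby data, and continuity
    -- of the solution map into `C⁰([0,T), C¹(𝕋)) ∩ C¹([0,T), L^∞(𝕋))`
    (∀ u₀ : C1Circle, ∃ T > 0, ∃ r > 0, ∃ S : C1Circle → ℝ → C1Circle,
      (∀ v₀ ∈ Metric.ball u₀ r, IsMHSSolution p x₀ T v₀ (S v₀)) ∧
      (∀ v₀ ∈ Metric.ball u₀ r,
        TendstoUniformlyOn S (S v₀) (𝓝 v₀) (Ico 0 T) ∧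
        TendstoUniformlyOn (fun w₀ => timeDeriv T (S w₀)) (timeDeriv T (S v₀)) (𝓝 v₀)
          (Ico 0 T))) := by
  refine ⟨fun T u₀ u v hu hv => hu.eqOn hv, fun u₀ => ?_⟩
  obtain ⟨T, hT, r, hr, γ, hγc, hγ⟩ := C1Circle.exists_lagrangian_flow p x₀ u₀
  -- Continuity holds up to the endpoint `T`; compactness of `[0, T]` then gives uniformity on `[0,
  -- T)`.
  have hSc : ContinuousOn (fun q => C1Circle.eulerian (γ q).1 (γ q).2)
      (Metric.ball u₀ r ×ˢ Icc 0 T) :=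
    C1Circle.continuousOn_eulerian.comp hγc fun q hq => ((hγ q.1 hq.1).2 q.2 hq.2).2
  have hsol : ∀ v₀ ∈ Metric.ball u₀ r, IsMHSSolution p x₀ T v₀
      fun t => C1Circle.eulerian (γ (v₀, t)).1 (γ (v₀, t)).2 := fun v₀ hv₀ => by
    refine IsMHSSolution.of_hasDerivWithinAt ?_ ?_ fun t ht => ?_
    · rw [(hγ v₀ hv₀).1, C1Circle.eulerian_zero]
    · exact hSc.comp (continuous_const.prodMk continuous_id).continuousOn
        fun t ht => ⟨hv₀, Ico_subset_Icc_self ht⟩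
    · exact (C1Circle.hasDerivWithinAt_eulerian (fun t ht => ((hγ v₀ hv₀).2 t ht).1)
        (fun t ht => ((hγ v₀ hv₀).2 t ht).2) (Ico_subset_Icc_self ht)).mono Ico_subset_Icc_self
  refine ⟨T, hT, r, hr, fun v₀ t => C1Circle.eulerian (γ (v₀, t)).1 (γ (v₀, t)).2, hsol,
    fun v₀ hv₀ => ?_⟩
  have hnhds : Metric.ball u₀ r ∈ 𝓝 v₀ := Metric.isOpen_ball.mem_nhds hv₀
  refine ⟨(tendstoUniformlyOn_of_continuousOn_prod hSc hnhds isCompact_Icc).mono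
    Ico_subset_Icc_self, ?_⟩
  have hDc : ContinuousOn (fun q => toLinf (C1Circle.mhsRhs p x₀
      (C1Circle.eulerian (γ q).1 (γ q).2))) (Metric.ball u₀ r ×ˢ Icc 0 T) :=
    toLinfIso.continuous.comp_continuousOn ((C1Circle.continuous_mhsRhs p x₀).comp_continuousOn hSc)
  refine (((tendstoUniformlyOn_of_continuousOn_prod hDc hnhds isCompact_Icc).mono
    Ico_subset_Icc_self).congr ?_).congr_right fun t ht => ((hsol v₀ hv₀).timeDeriv_eq ht).symm
  exact mem_of_superset hnhds fun w hw t ht => ((hsol w hw).timeDeriv_eq ht).symm
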